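/- Let $p\ge 5$ be a prime, fix an algebraic closure $\overline{\mathbb Q_p}$ of $\mathbb Q_p$, and let $\mu_d\subset\overline{\mathbb Q_p}$ be the group of $d$-th roots of unity. For $n\ge 0$ let $K_n=\mathbb Q_p(\mu_{p^{n+1}})$, $\Gamma_n=\mathrm{Gal}(K_n/K_0)$, $\Delta=\mathrm{Gal}(K_0/\mathbb Q_p)$. For $a\in\mathbb Z_p^*$ let $\omega(a)=\lim_m a^{p^m}\in\mu_{p-1}$ be the Teichmüller character and $\langle a\rangle=a/\omega(a)$; let $\gamma_n(a)\in\Gamma_n$ be the element acting on $\mu_{p^{n+1}}$ by $\zeta\mapsto\zeta^{\langle a\rangle}$, and let $\gamma_0$ denote the automorphism of $\mathbb Q_p(\mu_{p^\infty})$ acting on $\mu_{p^\infty}$ by $\zeta\mapsto\zeta^{1+p}$. For a character $\theta\in\mathrm{Hom}(\Delta,\mu_{p-1})$ and $a\in\mathbb Z_p^*$ write $\theta(a)$ for the value of $\theta$ at the element of $\Delta$ acting on $\mu_p$ by $\zeta\mapsto\zeta^a$; $\theta$ is even if $\theta(-1)=1$. Let $L/\mathbb Q_p$ be a finite extension inside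 $\overline{\mathbb Q_p}$ with valuation ring $O_L$, and let $a\in O_L$ be such that $a(a-1)$ is a unit of $O_L$. Mirimanoff's power series $M(T,\theta,a)\in O_L[[T]]$ is the power series that corresponds, under the isomorphism $O_L[[T]]\simeq\varprojlim_n O_L[\Gamma_n]$ sending $T$ to $\gamma_0-1$, to the compatible family $$M_n(\theta,a)=\sum_{\substack{1\le k\le p^{n+1}-1\\ p\nmid k}}\frac{a^k}{a^{p^{n+1}}-1}\,\theta(k)\,\omega^{-1}(k)\,\gamma_n(k)\in O_L[\Gamma_n],\qquad n\ge 0,$$ and $M'(T,\theta,a)$ is its derivative with respect to $T$. Theorem. Let $\theta\in\mathrm{Hom}(\Delta,\mu_{p-1})$ be even (the trivial character is allowed). There exists $\alpha\in\mu_{p-1}$ such that for every prime number $\ell$ with $\ell\equiv\alpha\pmod p$ and $\ell\ge p^2$, and for every finite extension $L$ of $\mathbb Q_p$ in $\overline{\mathbb Q_p}$ containing $\mu_\ell$, $$\sum_{\rho\in\mu_\ell\setminus\{1\}}M'(T,\theta,\rho)\not\equiv 0\pmod{p\,O_L[[T]]}.$$ -/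

import Mathlib

open scoped PowerSeries

noncomputable section

namespace Mirimanoff

variable (p : ℕ) [Fact p.Prime]

/-- `K n = ℚ_p(μ_{p^{n+1}})`, inside a fixed algebraic closure of `ℚ_p`. -/
def K (n : ℕ) : IntermediateField ℚ_[p] (PadicAlgCl p) :=
  IntermediateField.adjoin ℚ_[p] {z : PadicAlgCl p | z ^ p ^ (n + 1) = 1}

/-- `μ_p ⊆ μ_{p^{n+1}}`, so `K_0 ⊆ K_n`. -/
theorem K_zero_le (n : ℕ) : K p 0 ≤ K p n := by
  refine IntermediateField.adjoin.mono _ _ _ ?_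
  intro z hz
  simp only [Set.mem_ofPred_eq, zero_add, pow_one] at hz ⊢
  rw [pow_succ', pow_mul, hz, one_pow]

/-- `Γ_n = Gal(K_n / K_0)`, the automorphisms of `K_n` over `ℚ_p` that fix `K_0`. -/
abbrev Gam (n : ℕ) : Subgroup Gal(K p n/ℚ_[p]) :=
  (IntermediateField.restrict (K_zero_le p n)).fixingSubgroup

/-- `Δ = Gal(K_0 / ℚ_p)`. -/
abbrev Delta : Type := Gal(K p 0/ℚ_[p])

variable {p}

/-- `σ` acts on the roots of unity of order dividing `p^{n+1}` by `ζ ↦ ζ^z`, for `z ∈ ℤ_p`;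
the exponent only matters modulo `p^{n+1}`, and `z.appr (n + 1)` is a natural number
congruent to `z` modulo `p^{n+1}`. -/
def ActsByPow (n : ℕ) (σ : Gal(K p n/ℚ_[p])) (z : ℤ_[p]) : Prop :=
  ∀ ζ : K p n, ζ ^ p ^ (n + 1) = 1 → σ ζ = ζ ^ z.appr (n + 1)

/-- The Teichmüller character `ω(a) = lim a^{p^m}`. -/
def omega (a : ℤ_[p]) : ℤ_[p] :=
  Filter.limUnder Filter.atTop fun m : ℕ => a ^ p ^ m

/-- `⟨a⟩ = a / ω(a)`, for `a` a unit. -/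
def angle (a : ℤ_[p]) : ℤ_[p] :=
  a * Ring.inverse (omega a)

open Classical in
/-- For `z ≡ 1 mod p`, the unique element of `Γ_n` with `ζ ↦ ζ^z` on `μ_{p^{n+1}}`. -/
def gammaElt (n : ℕ) (z : ℤ_[p]) : Gam p n :=
  if h : ∃ σ : Gam p n, ActsByPow n σ.1 z then h.choose else 1

/-- `γ_n(a) ∈ Γ_n`, which acts by `ζ ↦ ζ^{⟨a⟩}` on `μ_{p^{n+1}}`. -/
def gam (n : ℕ) (a : ℤ_[p]) : Gam p n :=
  gammaElt n (angle a)

/-- The restriction to `K_n` of the generator `γ_0` of `Γ`: `ζ ↦ ζ^{1+p}`. -/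
def gamZero (p : ℕ) [Fact p.Prime] (n : ℕ) : Gam p n :=
  gammaElt n (1 + p)

open Classical in
/-- For `a ∈ ℤ_p^×`, the unique element `δ(a)` of `Δ` with `ζ ↦ ζ^a` on `μ_p`
(equivalently `ζ ↦ ζ^{ω(a)}`, as `ω(a) ≡ a mod p`). -/
def delta (a : ℤ_[p]) : Delta p :=
  if h : ∃ σ : Delta p, ActsByPow 0 σ a then h.choose else 1

variable (p) in
/-- The characters of `Δ`, `Hom(Δ, μ_{p-1})`; here `μ_{p-1} ⊆ ℤ_p^×`. -/
abbrev DeltaHat : Type := Delta p →* rootsOfUnity (p - 1) ℤ_[p]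

/-- The value `θ(a)`, for `a ∈ ℤ_p^×`. -/
def DeltaHat.val (θ : DeltaHat p) (a : ℤ_[p]) : ℤ_[p] :=
  ((θ (delta a) : ℤ_[p]ˣ) : ℤ_[p])

/-- `θ` is even: `θ(-1) = 1`. -/
def DeltaHat.IsEven (θ : DeltaHat p) : Prop :=
  θ.val (-1) = 1

/-- The valuation ring `O_L` of `L`: the integral closure of `ℤ_p` in `L`. -/
abbrev O (L : IntermediateField ℚ_[p] (PadicAlgCl p)) : Subalgebra ℤ_[p] L :=
  integralClosure ℤ_[p] L

variable {L : IntermediateField ℚ_[p] (PadicAlgCl p)}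

/-- `M_n(θ, a) = ∑ a^k / (a^{p^{n+1}} - 1) θ(k) ω^{-1}(k) γ_n(k) ∈ O_L[Γ_n]`, the sum over
`1 ≤ k ≤ p^{n+1} - 1` with `p ∤ k`. The denominator is a unit of `O_L`
when `a ≢ 1` modulo the maximal ideal. -/
def groupRingElt (θ : DeltaHat p) (a : O L) (n : ℕ) : MonoidAlgebra (O L) (Gam p n) :=
  ∑ k ∈ (Finset.Icc 1 (p ^ (n + 1) - 1)).filter (fun k => ¬ p ∣ k),
    MonoidAlgebra.single (gam n (k : ℤ_[p]))
      (a ^ k * Ring.inverse (a ^ p ^ (n + 1) - 1) *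
        algebraMap ℤ_[p] (O L) (θ.val k * Ring.inverse (omega (k : ℤ_[p]))))

/-- `F ∈ Λ_L = O_L[[T]]` is sent to `x ∈ O_L[Γ_n]` by the projection
`Λ_L → Λ_L / ω_n(T) Λ_L ≃ O_L[Γ_n]`, `T ↦ γ_0 - 1`, where `ω_n(T) = (1 + T)^{p^n} - 1`: some
polynomial congruent to `F` modulo `ω_n(T)` takes the value `x` at `γ_0 - 1`. -/
def MapsTo (n : ℕ) (F : (O L)⟦X⟧) (x : MonoidAlgebra (O L) (Gam p n)) : Prop :=
  ∃ Q : Polynomial (O L), ((1 + PowerSeries.X) ^ p ^ n - 1 : (O L)⟦X⟧) ∣ F - (Q : (O L)⟦X⟧) ∧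
    Polynomial.aeval (MonoidAlgebra.of (O L) (Gam p n) (gamZero p n) - 1) Q = x

open Classical in
/-- Mirimanoff's power series `M(T, θ, a) ∈ O_L[[T]]`: the unique power series that corresponds to
`(M_n(θ, a))_n` under `O_L[[T]] ≃ lim O_L[Γ_n]`, `T ↦ γ_0 - 1`. It is meant for
`a (a - 1)` a unit of `O_L`; the default value `0` is never used then. -/
def mirimanoff (θ : DeltaHat p) (a : O L) : (O L)⟦X⟧ :=
  if h : ∃! F : (O L)⟦X⟧, ∀ n, MapsTo n F (groupRingElt θ a n) then h.choose else 0

variable (L) in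
open Classical in
/-- The set `μ_ℓ \ {1}` of `ℓ`-th roots of unity in `O_L` other than `1`. -/
def muMinusOne (ℓ : ℕ) : Finset (O L) :=
  (Polynomial.nthRootsFinset ℓ (1 : O L)).erase 1

end Mirimanoff

end

/-!
Put `q = p^{n+1}` and let `S` be the sum of the series `M(T, θ, ρ)` over the nontrivial `ℓ`-th roots
of unity `ρ`. Any `ℓ > 1` prime to `p` will do, so the class `α = 1` is chosen.

*Reduction to finite level.* `M(T, θ, ρ)` is congruent to `∑ c_k (1 + T)^{lg k}` modulo
`ω_n = (1 + T)^{p^n} - 1`, where `⟨k⟩ ≡ (1 + p)^{lg k} mod q` (`dvd_mirimanoff_sub`; the series exists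
because `O_L` is compact, and is unique because the `ω_n` tend to `0`). Modulo `p` one has
`ω_n = T^{p^n}`, so `S' ≡ 0 mod p` forces the coefficient of every `(1 + T)^i` with `p ∤ i` in `S`
modulo `ω_n` to vanish modulo `p` (`dvd_mul_of_dvd_derivative`). Summing `ρ^k / (ρ^q - 1)` over `ρ` by
the substitution `η = ρ^q`, that coefficient becomes
`∑ (B - ⌊ℓ [ζ v] / q⌋) θ(ζ) ω(ζ)^{-1}`, the sum over the `(p - 1)`-st roots of unity `ζ` of `ℤ_p`. Here
`[z]` is the residue of `z` modulo `q`, `B` does not depend on `v` or `n`, and `v ∈ ℤ_p` is arbitrary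
subject to a condition modulo `p²` (`dvd_sum_teich`).

*Approximation.* As `n` grows, the points `([ζ v] / q)_ζ`, with `v` in a fixed class modulo `p²`,
become dense modulo `1` among the real vectors satisfying all integral linear relations between the
`ζ` (`eventually_exists_close`). This is Kronecker's theorem in the style of Weyl: one averages a
trigonometric polynomial with nonnegative coefficients that peaks at the target. So the fractional
parts can be replaced by any such real vector `x / ℓ` off the walls `x_ζ ∈ ℤ` (`dvd_sum_floor`).

*One wall.* For a complex embedding `s` and generic real `τ`, the vector `λ_ζ = Re s(ζ) + τ Im s(ζ)`
satisfies the relations, has `λ_{±1} = ±1`, and has no other integral coordinate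
(`exists_generic_functional`). Going from `(1 - η) λ` to `(1 + η) λ` with `η > 0` small changes
`⌊x_ζ⌋` only at `ζ = ±1`, hence the sum by `±(χ(1) - χ(-1))` with `χ = θ ω^{-1}`. As `θ` is even, `χ` is
odd, and this is `±2`, a unit: the two sums cannot both vanish modulo `p`.
-/

noncomputable section

namespace Mirimanoff

/-! ### Teichmüller representatives and the group `1 + pℤ_p` modulo powers of `p` -/

section PadicIntegers

variable {p : ℕ} [Fact p.Prime]

theorem not_dvd_of_pow_eq_one {ζ : ℤ_[p]} (h : ζ ^ (p - 1) = 1) : ¬ (p : ℤ_[p]) ∣ ζ := by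
  intro hd
  have h1 : IsUnit ζ := IsUnit.of_pow_eq_one h (Nat.sub_ne_zero_of_lt (Fact.out : p.Prime).one_lt)
  exact PadicInt.prime_p.not_isUnit (isUnit_of_dvd_unit hd h1)

theorem isUnit_of_not_dvd {a : ℤ_[p]} (h : ¬ (p : ℤ_[p]) ∣ a) : IsUnit a := by
  by_contra hu
  exact h ((PadicInt.norm_lt_one_iff_dvd a).1 (PadicInt.not_isUnit_iff.1 hu))

/-- Hensel's lemma for `X^{p-1} - 1`. -/
theorem exists_teichmuller {a : ℤ_[p]} (h : ¬ (p : ℤ_[p]) ∣ a) :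
    ∃ ζ : ℤ_[p], ζ ^ (p - 1) = 1 ∧ (p : ℤ_[p]) ∣ a - ζ := by
  have hp : p.Prime := Fact.out
  have ha : ‖a‖ = 1 := PadicInt.isUnit_iff.1 (isUnit_of_not_dvd h)
  have hpow : (p : ℤ_[p]) ∣ a ^ (p - 1) - 1 := by
    have h0 : PadicInt.toZMod a ≠ 0 := by
      intro h0
      have := (RingHom.mem_ker).2 h0
      rw [PadicInt.ker_toZMod, PadicInt.maximalIdeal_eq_span_p, Ideal.mem_span_singleton] at this
      exact h this
    have h1 := ZMod.pow_card_sub_one_eq_one h0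
    have h2 : a ^ (p - 1) - 1 ∈ RingHom.ker (PadicInt.toZMod (p := p)) := by
      rw [RingHom.mem_ker]; simp [h1]
    rwa [PadicInt.ker_toZMod, PadicInt.maximalIdeal_eq_span_p, Ideal.mem_span_singleton] at h2
  have hder : ‖((p - 1 : ℕ) : ℤ_[p])‖ = 1 := by
    rw [PadicInt.norm_natCast_eq_one_iff]
    exact (Nat.coprime_self_sub_right hp.one_le).2 (Nat.coprime_one_right p)
  have hF : ‖(Polynomial.X ^ (p - 1) - 1 : Polynomial ℤ_[p]).derivative.aeval a‖ = 1 := by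
    rw [Polynomial.derivative_sub, Polynomial.derivative_one, Polynomial.derivative_X_pow, sub_zero,
      map_mul, map_pow, Polynomial.aeval_X, Polynomial.aeval_C, norm_mul, norm_pow, ha, one_pow,
      mul_one]
    exact hder
  obtain ⟨z, hz1, hz2, -⟩ := hensels_lemma (F := (Polynomial.X ^ (p - 1) - 1 : Polynomial ℤ_[p]))
    (a := a) (by
      rw [hF]
      simpa using (PadicInt.norm_lt_one_iff_dvd _).2 hpow)
  refine ⟨z, ?_, ?_⟩
  · simpa [sub_eq_zero] using hz1
  · rw [hF, PadicInt.norm_lt_one_iff_dvd] at hz2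
    rw [← neg_sub]
    exact (dvd_neg).2 hz2

theorem pow_prime_pow_of_root {ζ : ℤ_[p]} (h : ζ ^ (p - 1) = 1) (m : ℕ) : ζ ^ p ^ m = ζ := by
  have h1 : ζ ^ p = ζ := by
    calc ζ ^ p = ζ ^ (p - 1 + 1) := by rw [Nat.sub_add_cancel (Fact.out : p.Prime).one_le]
      _ = ζ := by rw [pow_succ, h, one_mul]
  induction m with
  | zero => simp
  | succ m ih => rw [pow_succ, pow_mul, ih, h1]

/-- `ω(a)` is the `(p-1)`-st root of unity congruent to `a`. -/
theorem omega_eq {a ζ : ℤ_[p]} (h : ζ ^ (p - 1) = 1) (ha : (p : ℤ_[p]) ∣ a - ζ) :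
    omega a = ζ := by
  have hp : p.Prime := Fact.out
  refine Filter.Tendsto.limUnder_eq ?_
  rw [tendsto_iff_norm_sub_tendsto_zero]
  have hlim : Filter.Tendsto (fun m : ℕ => ((p : ℝ)⁻¹) ^ (m + 1)) Filter.atTop (nhds 0) :=
    (tendsto_pow_atTop_nhds_zero_of_lt_one (by positivity)
      (inv_lt_one_of_one_lt₀ (by exact_mod_cast hp.one_lt))).comp (Filter.tendsto_add_atTop_nat 1)
  refine squeeze_zero (fun _ => norm_nonneg _) (fun m => ?_) hlim
  have h1 := dvd_sub_pow_of_dvd_sub ha m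
  rw [pow_prime_pow_of_root h] at h1
  obtain ⟨c, hc⟩ := h1
  rw [hc, norm_mul, norm_pow, PadicInt.norm_p]
  exact mul_le_of_le_one_right (by positivity) (PadicInt.norm_le_one c)

theorem root_eq_of_dvd_sub {ζ ζ' : ℤ_[p]} (h : ζ ^ (p - 1) = 1) (h' : ζ' ^ (p - 1) = 1)
    (hd : (p : ℤ_[p]) ∣ ζ - ζ') : ζ = ζ' := by
  rw [← omega_eq h (by simp : (p : ℤ_[p]) ∣ ζ - ζ), omega_eq h' hd]

theorem exists_one_add_mul_pow (hp2 : p ≠ 2) (x : ℤ_[p]) (m : ℕ) :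
    ∃ y, (1 + p * x) ^ p ^ m = 1 + (p : ℤ_[p]) ^ (m + 1) * (x + p * y) := by
  have hp : p.Prime := Fact.out
  obtain ⟨y, hy⟩ := ZMod.exists_one_add_mul_pow_prime_pow_eq (R := ℤ_[p]) (u := p) (v := p) hp
    dvd_rfl (by
      have : 3 ≤ p := lt_of_le_of_ne hp.two_le (Ne.symm hp2)
      calc (p : ℤ_[p]) * p * p = (p : ℤ_[p]) ^ 3 := by ring
        _ ∣ _ := pow_dvd_pow _ this) x m
  exact ⟨y, by rw [hy, pow_succ]⟩

/-- `1 + p` generates `1 + pℤ_p` modulo `p^{n+1}`. -/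
theorem exists_pow_one_add (hp2 : p ≠ 2) {z : ℤ_[p]} (hz : (p : ℤ_[p]) ∣ z - 1) (n : ℕ) :
    ∃ i < p ^ n, (p : ℤ_[p]) ^ (n + 1) ∣ z - (1 + p) ^ i := by
  have hp : p.Prime := Fact.out
  induction n with
  | zero => exact ⟨0, by simp, by simpa using hz⟩
  | succ n ih =>
    obtain ⟨i, hi, c, hc⟩ := ih
    obtain ⟨y, hy⟩ := exists_one_add_mul_pow hp2 1 n
    rw [mul_one] at hy
    obtain ⟨d, hd⟩ := Ideal.mem_span_singleton.1 (PadicInt.appr_spec 1 c)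
    set j := c.appr 1
    have hj : j < p := by simpa using c.appr_lt 1
    refine ⟨i + p ^ n * j, ?_, ?_⟩
    · calc i + p ^ n * j < p ^ n + p ^ n * j := by omega
        _ = p ^ n * (j + 1) := by ring
        _ ≤ p ^ n * p := Nat.mul_le_mul_left _ hj
        _ = p ^ (n + 1) := by ring
    · have h1 : (p : ℤ_[p]) ^ (n + 2) ∣ (1 + (p : ℤ_[p]) ^ (n + 1) * (1 + p * y)) ^ j
          - (1 + p ^ (n + 1) * (1 + p * y) * j) := by
        have h2 : ((p : ℤ_[p]) ^ (n + 1) * (1 + p * y)) ^ 2 ∣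
            (1 + (p : ℤ_[p]) ^ (n + 1) * (1 + p * y)) ^ j
            - (1 + p ^ (n + 1) * (1 + p * y) * j) := by
          generalize (p : ℤ_[p]) ^ (n + 1) * (1 + p * y) = x
          clear_value j
          clear hd hj
          induction j with
          | zero => simp
          | succ k ihk =>
            obtain ⟨e, he⟩ := ihk
            refine ⟨e * (1 + x) + k, ?_⟩
            rw [sub_eq_iff_eq_add] at he
            rw [pow_succ, he]
            push_cast
            ring
        refine dvd_trans ?_ h2
        rw [mul_pow, ← pow_mul]
        exact Dvd.dvd.mul_right (pow_dvd_pow _ (by omega)) _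
      have h3 : (p : ℤ_[p]) ∣ (1 + p) ^ i - 1 := by
        simpa using sub_dvd_pow_sub_pow (1 + (p : ℤ_[p])) 1 i
      obtain ⟨e, he⟩ := h1
      obtain ⟨f, hf⟩ := h3
      rw [pow_add (1 + (p : ℤ_[p])) i, pow_mul, hy]
      rw [sub_eq_iff_eq_add] at he hc
      rw [sub_eq_iff_eq_add] at hd hf
      rw [he, hc]
      refine ⟨d - f * (1 + p * y) * j - y * j - (1 + p) ^ i * e, ?_⟩
      rw [hf]
      nth_rw 1 [hd]
      ring

/-- The order of `1 + p` modulo `p^{n+1}` is `p^n`. -/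
theorem pow_one_add_injective (hp2 : p ≠ 2) {n i j : ℕ}
    (h : (p : ℤ_[p]) ^ (n + 1) ∣ (1 + p) ^ i - (1 + p) ^ j) : i ≡ j [MOD p ^ n] := by
  have hp : p.Prime := Fact.out
  have h1 : (1 + p : ZMod (p ^ (n + 1))) ^ i = (1 + p) ^ j := by
    have : (1 + (p : ℤ_[p])) ^ i - (1 + p) ^ j ∈ RingHom.ker (PadicInt.toZModPow (p := p) (n + 1)) := by
      rw [PadicInt.ker_toZModPow, Ideal.mem_span_singleton]; exact h
    rw [RingHom.mem_ker] at this
    simpa [sub_eq_zero] using this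
  have ho := ZMod.orderOf_one_add_prime hp hp2 n
  have hu : IsUnit (1 + p : ZMod (p ^ (n + 1))) := by
    refine IsUnit.of_pow_eq_one (n := p ^ n) ?_ (pow_ne_zero _ hp.ne_zero)
    rw [← ho]; exact pow_orderOf_eq_one _
  obtain ⟨u, hu⟩ := hu
  rw [← hu, orderOf_units] at ho
  rw [← hu, ← Units.val_pow_eq_pow_val, ← Units.val_pow_eq_pow_val, Units.val_inj,
    pow_eq_pow_iff_modEq, ho] at h1
  exact h1

theorem pow_one_add_congr (hp2 : p ≠ 2) {n i j : ℕ} (h : i ≡ j [MOD p ^ n]) :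
    (p : ℤ_[p]) ^ (n + 1) ∣ (1 + p) ^ i - (1 + p) ^ j := by
  obtain ⟨y, hy⟩ := exists_one_add_mul_pow hp2 1 n
  rw [mul_one] at hy
  wlog hij : i ≤ j generalizing i j
  · rw [← neg_sub, dvd_neg]
    exact this h.symm (le_of_not_ge hij)
  obtain ⟨c, hc⟩ := (Nat.modEq_iff_dvd' hij).1 h
  obtain rfl : j = i + p ^ n * c := by omega
  rw [pow_add (1 + (p : ℤ_[p])) i, pow_mul, hy]
  have : (p : ℤ_[p]) ^ (n + 1) ∣ (1 + (p : ℤ_[p]) ^ (n + 1) * (1 + p * y)) ^ c - 1 :=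
    dvd_trans (Dvd.intro (1 + p * y) (by ring)) (sub_dvd_pow_sub_pow
      (1 + (p : ℤ_[p]) ^ (n + 1) * (1 + p * y)) 1 c |>.trans (by simp))
  have := this.mul_left (-(1 + p) ^ i : ℤ_[p])
  convert this using 1
  ring

theorem appr_eq_of_dvd {x y : ℤ_[p]} {n : ℕ} (h : (p : ℤ_[p]) ^ n ∣ x - y) :
    x.appr n = y.appr n := by
  have hx := Ideal.mem_span_singleton.1 (PadicInt.appr_spec n x)
  have hy := Ideal.mem_span_singleton.1 (PadicInt.appr_spec n y)
  have h1 : (p : ℤ_[p]) ^ n ∣ (((x.appr n : ℤ) - (y.appr n : ℤ) : ℤ) : ℤ_[p]) := by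
    have := (h.sub hx).add hy
    push_cast
    convert this using 1
    ring
  rw [PadicInt.pow_p_dvd_int_iff] at h1
  have hm : (y.appr n) ≡ (x.appr n) [MOD p ^ n] := (Nat.modEq_iff_dvd).2 (by exact_mod_cast h1)
  exact (Nat.ModEq.eq_of_lt_of_lt hm (y.appr_lt n) (x.appr_lt n)).symm

theorem dvd_sub_appr (x : ℤ_[p]) (n : ℕ) : (p : ℤ_[p]) ^ n ∣ x - x.appr n :=
  Ideal.mem_span_singleton.1 (PadicInt.appr_spec n x)

theorem appr_natCast {k n : ℕ} (h : k < p ^ n) : ((k : ℤ_[p])).appr n = k := by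
  have h1 := dvd_sub_appr (k : ℤ_[p]) n
  have h2 : (p : ℤ_[p]) ^ n ∣ (((k : ℤ) - ((k : ℤ_[p]).appr n : ℤ) : ℤ) : ℤ_[p]) := by
    push_cast; exact h1
  rw [PadicInt.pow_p_dvd_int_iff] at h2
  have hm : ((k : ℤ_[p]).appr n) ≡ k [MOD p ^ n] := (Nat.modEq_iff_dvd).2 (by exact_mod_cast h2)
  exact Nat.ModEq.eq_of_lt_of_lt hm ((k : ℤ_[p]).appr_lt n) h

theorem dvd_natCast_iff {k : ℕ} : (p : ℤ_[p]) ∣ (k : ℤ_[p]) ↔ p ∣ k := by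
  have := PadicInt.pow_p_dvd_int_iff (p := p) 1 (k : ℤ)
  simp only [pow_one, Int.cast_natCast] at this
  rw [this]; exact Int.natCast_dvd_natCast

theorem dvd_of_pow_dvd {a : ℤ_[p]} {n : ℕ} (h : (p : ℤ_[p]) ^ (n + 1) ∣ a) : (p : ℤ_[p]) ∣ a :=
  (dvd_pow_self _ (Nat.succ_ne_zero n)).trans h

end PadicIntegers

/-! ### Galois groups of the cyclotomic tower over `ℚ_p` -/

section CyclotomicTower

variable {p : ℕ} [Fact p.Prime]

theorem exists_primitiveRoot_K (p : ℕ) [Fact p.Prime] (n : ℕ) :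
    ∃ ζ : K p n, IsPrimitiveRoot ζ (p ^ (n + 1)) := by
  have hp : p.Prime := Fact.out
  have : NeZero (p ^ (n + 1)) := ⟨pow_ne_zero _ hp.ne_zero⟩
  obtain ⟨z, hz⟩ := HasEnoughRootsOfUnity.exists_primitiveRoot (PadicAlgCl p) (p ^ (n + 1))
  have hmem : z ∈ K p n := IntermediateField.subset_adjoin _ _ hz.pow_eq_one
  refine ⟨⟨z, hmem⟩, ?_⟩
  rw [← IsPrimitiveRoot.coe_submonoidClass_iff]
  exact hz

theorem algHom_ext_K {n : ℕ} {E : Type*} [Field E] [Algebra ℚ_[p] E] {f g : K p n →ₐ[ℚ_[p]] E}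
    (h : ∀ ζ : K p n, ζ ^ p ^ (n + 1) = 1 → f ζ = g ζ) : f = g := by
  refine IntermediateField.algHom_ext_of_eq_adjoin ℚ_[p] (S := K p n) rfl ?_
  intro x hx
  refine h _ (Subtype.ext ?_)
  simpa using hx

instance isCyclotomicExtension_K (p : ℕ) [Fact p.Prime] (n : ℕ) :
    IsCyclotomicExtension {p ^ (n + 1)} ℚ_[p] (K p n) := by
  have hp : p.Prime := Fact.out
  have hne : NeZero (p ^ (n + 1)) := ⟨pow_ne_zero _ hp.ne_zero⟩
  obtain ⟨z, hz⟩ := HasEnoughRootsOfUnity.exists_primitiveRoot (PadicAlgCl p) (p ^ (n + 1))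
  have hK : K p n = IntermediateField.adjoin ℚ_[p] {z} := by
    apply le_antisymm
    · rw [K, IntermediateField.adjoin_le_iff]
      intro x hx
      have hx' : x ^ p ^ (n + 1) = 1 := hx
      obtain ⟨i, -, hi⟩ := hz.eq_pow_of_pow_eq_one hx'
      have hz' : z ∈ IntermediateField.adjoin ℚ_[p] {z} :=
        IntermediateField.mem_adjoin_simple_self _ _
      rw [← hi]
      exact pow_mem hz' i
    · rw [IntermediateField.adjoin_simple_le_iff]
      exact IntermediateField.subset_adjoin _ _ hz.pow_eq_one
  rw [hK]
  exact hz.intermediateField_adjoin_isCyclotomicExtension ℚ_[p]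

/-- The cyclotomic polynomial of prime power level is irreducible over `ℚ_p`, since its translate by
`1` is an Eisenstein polynomial. -/
theorem irreducible_cyclotomic (p : ℕ) [Fact p.Prime] (n : ℕ) :
    Irreducible (Polynomial.cyclotomic (p ^ (n + 1)) ℚ_[p]) := by
  have hp : p.Prime := Fact.out
  have hE := cyclotomic_prime_pow_comp_X_add_one_isEisensteinAt p n
  set f : Polynomial ℤ_[p] := (Polynomial.cyclotomic (p ^ (n + 1)) ℤ_[p]).comp (Polynomial.X + 1)
    with hf
  have hX : (Polynomial.X + 1 : Polynomial ℤ_[p]) = Polynomial.X + Polynomial.C 1 := by simp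
  have hmonic : f.Monic := by
    rw [hf, hX]
    refine (Polynomial.cyclotomic.monic _ _).comp (Polynomial.monic_X_add_C 1) fun h => ?_
    rw [Polynomial.natDegree_X_add_C] at h
    exact zero_ne_one h.symm
  have hmap : f = ((Polynomial.cyclotomic (p ^ (n + 1)) ℤ).comp (Polynomial.X + 1)).map
      (Int.castRingHom ℤ_[p]) := by
    rw [Polynomial.map_comp, Polynomial.map_cyclotomic]
    simp [hf]
  have hdeg : f.natDegree = ((Polynomial.cyclotomic (p ^ (n + 1)) ℤ).comp
      (Polynomial.X + 1)).natDegree := by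
    rw [hmap]
    exact Polynomial.natDegree_map_eq_of_injective (RingHom.injective_int _) _
  have hEp : f.IsEisensteinAt (Ideal.span {(p : ℤ_[p])}) := by
    have hprime : (Ideal.span {(p : ℤ_[p])}).IsPrime :=
      (Ideal.span_singleton_prime PadicInt.prime_p.ne_zero).2 PadicInt.prime_p
    refine hmonic.isEisensteinAt_of_mem_of_notMem hprime.ne_top (fun {i} hi => ?_) ?_
    · have h1 := hE.mem (n := i) (by rw [← hdeg]; exact hi)
      rw [Submodule.mem_span_singleton] at h1
      obtain ⟨c, hc⟩ := h1
      rw [hmap, Polynomial.coeff_map, ← hc, Ideal.mem_span_singleton]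
      simp
    · have h1 := hE.notMem
      rw [hmap, Polynomial.coeff_map, Ideal.span_singleton_pow, Ideal.mem_span_singleton]
      intro h2
      apply h1
      rw [eq_intCast, PadicInt.pow_p_dvd_int_iff] at h2
      rw [show Submodule.span ℤ {(p : ℤ)} = Ideal.span {(p : ℤ)} from rfl,
        Ideal.span_singleton_pow, Ideal.mem_span_singleton]
      exact h2
  have hirr : Irreducible f := by
    refine hEp.irreducible ((Ideal.span_singleton_prime PadicInt.prime_p.ne_zero).2
      PadicInt.prime_p) hmonic.isPrimitive ?_
    rw [hf, hX, Polynomial.natDegree_comp, Polynomial.natDegree_X_add_C, mul_one,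
      Polynomial.natDegree_cyclotomic]
    exact Nat.totient_pos.2 (pow_pos hp.pos _)
  have hirr' : Irreducible (Polynomial.cyclotomic (p ^ (n + 1)) ℤ_[p]) := by
    rw [← MulEquiv.irreducible_iff (Polynomial.taylorEquiv (1 : ℤ_[p]))]
    convert hirr using 1
    rw [hf, hX]
    exact Polynomial.taylor_apply ..
  rw [(Polynomial.cyclotomic.monic _ _).irreducible_iff_irreducible_map_fraction_map (K := ℚ_[p]),
    Polynomial.map_cyclotomic] at hirr'
  exact hirr'

/-- `Gal(K_n/ℚ_p)` is all of `(ℤ/p^{n+1})ˣ`, by irreducibility of the cyclotomic polynomial. -/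
theorem exists_actsByPow (n : ℕ) {z : ℤ_[p]} (hz : ¬ (p : ℤ_[p]) ∣ z) :
    ∃ σ : Gal(K p n/ℚ_[p]), ActsByPow n σ z := by
  have hp : p.Prime := Fact.out
  have hne : NeZero (p ^ (n + 1)) := ⟨pow_ne_zero _ hp.ne_zero⟩
  have hζ := IsCyclotomicExtension.zeta_spec (p ^ (n + 1)) ℚ_[p] (K p n)
  have hcop : (z.appr (n + 1)).Coprime (p ^ (n + 1)) := by
    refine Nat.Coprime.pow_right _ (Nat.Coprime.symm ((hp.coprime_iff_not_dvd).2 fun h => hz ?_))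
    have h1 := dvd_of_pow_dvd (dvd_sub_appr z (n + 1))
    have h2 := (dvd_natCast_iff (p := p)).2 h
    simpa using h1.add h2
  refine ⟨IsCyclotomicExtension.fromZetaAut (hζ.pow_of_coprime _ hcop) (irreducible_cyclotomic p n),
    fun ζ h => ?_⟩
  obtain ⟨i, -, rfl⟩ := hζ.eq_pow_of_pow_eq_one h
  rw [map_pow, IsCyclotomicExtension.fromZetaAut_spec, ← pow_mul, ← pow_mul, mul_comm]

theorem ActsByPow.unique {n : ℕ} {σ τ : Gal(K p n/ℚ_[p])} {z : ℤ_[p]} (hσ : ActsByPow n σ z)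
    (hτ : ActsByPow n τ z) : σ = τ := by
  apply AlgEquiv.coe_toAlgHom_injective
  exact algHom_ext_K fun ζ h => (hσ ζ h).trans (hτ ζ h).symm

theorem pow_appr_eq {n : ℕ} {M : Type*} [Monoid M] {ζ : M} (h : ζ ^ p ^ (n + 1) = 1) {z : ℤ_[p]}
    {k : ℕ} (hk : (p : ℤ_[p]) ^ (n + 1) ∣ z - k) : ζ ^ z.appr (n + 1) = ζ ^ k := by
  have h1 : z.appr (n + 1) ≡ k [MOD p ^ (n + 1)] := by
    have h2 : (p : ℤ_[p]) ^ (n + 1) ∣ (((k : ℤ) - (z.appr (n + 1) : ℤ) : ℤ) : ℤ_[p]) := by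
      push_cast
      have := (dvd_sub_appr z (n + 1)).sub hk
      convert this using 1
      ring
    rw [PadicInt.pow_p_dvd_int_iff] at h2
    exact (Nat.modEq_iff_dvd).2 (by exact_mod_cast h2)
  rw [← pow_mod_orderOf ζ (z.appr (n + 1)), ← pow_mod_orderOf ζ k,
    h1.of_dvd (orderOf_dvd_of_pow_eq_one h)]

theorem ActsByPow.mem_Gam {n : ℕ} {σ : Gal(K p n/ℚ_[p])} {z : ℤ_[p]} (hσ : ActsByPow n σ z)
    (hz : (p : ℤ_[p]) ∣ z - 1) : σ ∈ Gam p n := by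
  rw [IntermediateField.mem_fixingSubgroup_iff]
  intro x hx
  rw [IntermediateField.mem_restrict] at hx
  have h : (σ : K p n →ₐ[ℚ_[p]] K p n).comp (IntermediateField.inclusion (K_zero_le p n)) =
      IntermediateField.inclusion (K_zero_le p n) := by
    refine algHom_ext_K fun ζ h => ?_
    set ξ := IntermediateField.inclusion (K_zero_le p n) ζ with hξ
    have h1 : ξ ^ p ^ (0 + 1) = 1 := by rw [hξ, ← map_pow, h, map_one]
    have h2 : ξ ^ p ^ (n + 1) = 1 := by
      rw [zero_add, pow_one] at h1
      rw [pow_succ', pow_mul, h1, one_pow]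
    change σ ξ = ξ
    rw [hσ ξ h2]
    have h3 : (p : ℤ_[p]) ^ (0 + 1) ∣ z - ((z.appr (n + 1) : ℕ) : ℤ_[p]) :=
      (pow_dvd_pow _ (by omega)).trans (dvd_sub_appr z (n + 1))
    rw [← pow_appr_eq h1 h3, pow_appr_eq h1 (k := 1) (by simpa using hz), pow_one]
  exact DFunLike.congr_fun h ⟨x, hx⟩

theorem actsByPow_gammaElt (n : ℕ) {z : ℤ_[p]} (hz : (p : ℤ_[p]) ∣ z - 1) :
    ActsByPow n (gammaElt n z).1 z := by
  have hz' : ¬ (p : ℤ_[p]) ∣ z := fun h => PadicInt.prime_p.not_isUnit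
    (isUnit_of_dvd_one (by simpa using (dvd_sub h hz)))
  obtain ⟨σ, hσ⟩ := exists_actsByPow n hz'
  have h : ∃ σ : Gam p n, ActsByPow n σ.1 z := ⟨⟨σ, hσ.mem_Gam hz⟩, hσ⟩
  rw [gammaElt, dif_pos h]
  exact h.choose_spec

theorem gamZero_pow_apply (n i : ℕ) {ζ : K p n} (h : ζ ^ p ^ (n + 1) = 1) :
    ((gamZero p n ^ i : Gam p n) : Gal(K p n/ℚ_[p])) ζ = ζ ^ (1 + p) ^ i := by
  have h0 : (gamZero p n : Gal(K p n/ℚ_[p])) ζ = ζ ^ (1 + p) := by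
    rw [gamZero, actsByPow_gammaElt n (by simp) ζ h]
    exact pow_appr_eq h (by simp)
  induction i with
  | zero => simp
  | succ i ih =>
    rw [pow_succ', Subgroup.coe_mul, AlgEquiv.mul_apply, ih, map_pow, h0, ← pow_mul, pow_succ']

/-- The discrete logarithm to the base `γ₀` in `Γ_n` is the one to the base `1 + p`. -/
theorem gammaElt_eq_pow {n i : ℕ} {z : ℤ_[p]} (hz : (p : ℤ_[p]) ^ (n + 1) ∣ z - (1 + p) ^ i) :
    gammaElt n z = gamZero p n ^ i := by
  have h1 : (p : ℤ_[p]) ∣ z - 1 := by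
    have h2 : (p : ℤ_[p]) ∣ (1 + p) ^ i - 1 := by
      simpa using sub_dvd_pow_sub_pow (1 + (p : ℤ_[p])) 1 i
    simpa using (dvd_of_pow_dvd hz).add h2
  refine Subtype.ext ((actsByPow_gammaElt n h1).unique fun ζ h => ?_)
  rw [gamZero_pow_apply n i h]
  exact (pow_appr_eq h (by simpa using hz)).symm

theorem gamZero_pow_eq_one (hp2 : p ≠ 2) (n : ℕ) : gamZero p n ^ p ^ n = 1 := by
  rw [← gammaElt_eq_pow (z := (1 + p) ^ p ^ n) (by simp), ← pow_zero (gamZero p n)]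
  exact gammaElt_eq_pow (pow_one_add_congr hp2 (by simp [Nat.ModEq]))

theorem gamZero_pow_injective (hp2 : p ≠ 2) {n i j : ℕ}
    (h : gamZero p n ^ i = gamZero p n ^ j) : i ≡ j [MOD p ^ n] := by
  obtain ⟨ζ, hζ⟩ := exists_primitiveRoot_K p n
  have h1 : ζ ^ (1 + p) ^ i = ζ ^ (1 + p) ^ j := by
    rw [← gamZero_pow_apply n i hζ.pow_eq_one, h, gamZero_pow_apply n j hζ.pow_eq_one]
  apply pow_one_add_injective hp2
  have hne : ζ ≠ 0 := hζ.ne_zero (pow_ne_zero _ (Fact.out : p.Prime).ne_zero)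
  have h2 : (1 + p) ^ j ≡ (1 + p) ^ i [MOD p ^ (n + 1)] := by
    lift ζ to (K p n)ˣ using hne.isUnit
    rw [← Units.val_pow_eq_pow_val, ← Units.val_pow_eq_pow_val, Units.val_inj,
      pow_eq_pow_iff_modEq] at h1
    rw [hζ.eq_orderOf, orderOf_units]
    exact h1.symm
  have h3 := (Nat.modEq_iff_dvd).1 h2
  have h4 := (PadicInt.pow_p_dvd_int_iff (p := p) (n + 1) (((1 + p) ^ i : ℕ) - ((1 + p) ^ j : ℕ))).2
    (by exact_mod_cast h3)
  simpa using h4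

/-- `δ` factors through `ℤ/p`, as `a ↦ a.appr 1` does. -/
theorem delta_congr {a b : ℤ_[p]} (h : (p : ℤ_[p]) ∣ a - b) : delta a = delta b := by
  have h1 : a.appr (0 + 1) = b.appr (0 + 1) := appr_eq_of_dvd (by simpa using h)
  have h2 : (fun σ : Delta p => ActsByPow 0 σ a) = fun σ => ActsByPow 0 σ b := by
    funext σ
    simp only [ActsByPow, h1]
  have h3 : ∀ P Q : Delta p → Prop, P = Q → (open Classical in
      (if h : ∃ σ, P σ then h.choose else 1) = if h : ∃ σ, Q σ then h.choose else 1) := by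
    rintro P _ rfl
    rfl
  exact h3 _ _ h2

theorem delta_one : delta (1 : ℤ_[p]) = 1 := by
  have h : ActsByPow 0 (1 : Delta p) 1 := fun ζ h => by
    rw [pow_appr_eq h (k := 1) (by simp), pow_one, AlgEquiv.one_apply]
  have h' : ∃ σ : Delta p, ActsByPow 0 σ 1 := ⟨1, h⟩
  rw [delta, dif_pos h']
  exact h'.choose_spec.unique h

theorem DeltaHat.val_congr (θ : DeltaHat p) {a b : ℤ_[p]} (h : (p : ℤ_[p]) ∣ a - b) :
    θ.val a = θ.val b := by
  rw [DeltaHat.val, DeltaHat.val, delta_congr h]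

theorem DeltaHat.val_one (θ : DeltaHat p) : θ.val 1 = 1 := by
  rw [DeltaHat.val, delta_one, map_one]
  rfl

end CyclotomicTower

/-! ### Power series modulo `(1 + X)^{p^n} - 1` -/

section PowerSeriesLimits

open PowerSeries

variable {R : Type*} [CommRing R] {p : ℕ}

theorem pow_dvd_choose_prime_pow (hp : p.Prime) {n a j : ℕ} (ha : a ≠ 0) (haj : a ≤ j) :
    p ^ (n - j) ∣ (p ^ n).choose a := by
  rcases lt_or_ge (p ^ n) a with h | h
  · rw [Nat.choose_eq_zero_of_lt h]; exact dvd_zero _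
  · rw [hp.pow_dvd_iff_le_factorization (Nat.choose_pos h).ne',
      Nat.factorization_choose_prime_pow hp h ha]
    have := Nat.factorization_lt p ha
    omega

theorem pow_dvd_coeff_one_add_X_pow_sub_one (hp : p.Prime) {n a j : ℕ} (haj : a ≤ j) :
    (p : R) ^ (n - j) ∣ coeff a ((1 + X) ^ p ^ n - 1 : R⟦X⟧) := by
  have h : ((1 + X) ^ p ^ n - 1 : R⟦X⟧) =
      (((1 + Polynomial.X) ^ p ^ n - 1 : Polynomial R) : R⟦X⟧) := by simp
  rw [h, Polynomial.coeff_coe, Polynomial.coeff_sub, Polynomial.coeff_one_add_X_pow,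
    Polynomial.coeff_one]
  rcases eq_or_ne a 0 with rfl | ha
  · simp
  · rw [if_neg ha, sub_zero, ← Nat.cast_pow]
    exact Nat.cast_dvd_cast (pow_dvd_choose_prime_pow hp ha haj)

/-- A power series divisible by all the `ω_n = (1 + X)^{p^n} - 1` vanishes, if `R` is `p`-adically
separated. -/
theorem eq_zero_of_forall_dvd (hp : p.Prime) (hsep : ∀ x : R, (∀ n : ℕ, (p : R) ^ n ∣ x) → x = 0)
    {H : R⟦X⟧} (h : ∀ n, ((1 + X) ^ p ^ n - 1 : R⟦X⟧) ∣ H) : H = 0 := by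
  ext j
  rw [map_zero]
  refine hsep _ fun m => ?_
  obtain ⟨G, hG⟩ := h (m + j)
  rw [hG, coeff_mul]
  refine Finset.dvd_sum fun x hx => Dvd.dvd.mul_right ?_ _
  have h1 : x.1 ≤ j := by
    have := Finset.HasAntidiagonal.mem_antidiagonal.1 hx
    omega
  simpa using pow_dvd_coeff_one_add_X_pow_sub_one (R := R) hp (n := m + j) h1

open scoped PowerSeries.WithPiTopology in
/-- `R[[X]] → lim R[[X]] / ω_n` is bijective for a compact `p`-adically separated ring `R`.
Surjectivity is compactness: the cosets of the closed ideals `(ω_n)` are compact. -/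
theorem existsUnique_forall_dvd_sub [TopologicalSpace R] [IsTopologicalRing R] [CompactSpace R]
    [T2Space R] (hp : p.Prime) (hsep : ∀ x : R, (∀ n : ℕ, (p : R) ^ n ∣ x) → x = 0)
    {P : ℕ → R⟦X⟧} (hP : ∀ n, ((1 + X) ^ p ^ n - 1 : R⟦X⟧) ∣ P (n + 1) - P n) :
    ∃! F : R⟦X⟧, ∀ n, ((1 + X) ^ p ^ n - 1 : R⟦X⟧) ∣ F - P n := by
  have hcomp : CompactSpace R⟦X⟧ := inferInstanceAs (CompactSpace ((Unit →₀ ℕ) → R))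
  have hcl : ∀ n, IsCompact {F : R⟦X⟧ | ((1 + X) ^ p ^ n - 1 : R⟦X⟧) ∣ F - P n} := by
    intro n
    have : {F : R⟦X⟧ | ((1 + X) ^ p ^ n - 1 : R⟦X⟧) ∣ F - P n} =
        Set.range fun G : R⟦X⟧ => P n + ((1 + X) ^ p ^ n - 1 : R⟦X⟧) * G := by
      ext F
      simp only [Set.mem_ofPred_eq, Set.mem_range, dvd_def]
      exact exists_congr fun G => ⟨fun h => by rw [← h]; ring, fun h => by rw [← h]; ring⟩
    rw [this]
    exact isCompact_range (continuous_const.add (continuous_const.mul continuous_id))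
  obtain ⟨F, hF⟩ := IsCompact.nonempty_iInter_of_sequence_nonempty_isCompact_isClosed
    (fun n => {F : R⟦X⟧ | ((1 + X) ^ p ^ n - 1 : R⟦X⟧) ∣ F - P n})
    (fun n F hF => by
      have h1 : ((1 + X) ^ p ^ n - 1 : R⟦X⟧) ∣ (1 + X) ^ p ^ (n + 1) - 1 := by
        rw [pow_succ p n, pow_mul]
        exact sub_one_dvd_pow_sub_one _ _
      have h2 : ((1 + X) ^ p ^ n - 1 : R⟦X⟧) ∣ F - P (n + 1) := h1.trans hF
      simpa using h2.add (hP n))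
    (fun n => ⟨P n, by simp⟩) (hcl 0) (fun n => (hcl n).isClosed)
  refine ⟨F, fun n => Set.mem_iInter.1 hF n, fun G hG => ?_⟩
  refine sub_eq_zero.1 (eq_zero_of_forall_dvd hp hsep fun n => ?_)
  have := dvd_sub (hG n) (Set.mem_iInter.1 hF n)
  simpa using this

end PowerSeriesLimits

section Coefficients

variable {R : Type*} [CommRing R]

/-- If a power series is congruent modulo `ω_n` to `∑ c_i (1 + X)^i`, the sum over `i < p^n`,
and its derivative vanishes modulo `p`, then so do all `i c_i`: modulo `p` one has
`ω_n = X^{p^n}`, whose derivative vanishes too. -/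
theorem dvd_mul_of_dvd_derivative {p : ℕ} (hp : p.Prime) {n : ℕ} (hn : n ≠ 0) {S : R⟦X⟧} {c : ℕ → R}
    (hS : ((1 + PowerSeries.X) ^ p ^ n - 1 : R⟦X⟧) ∣
      S - ((∑ i ∈ Finset.range (p ^ n), Polynomial.C (c i) * (1 + Polynomial.X) ^ i :
        Polynomial R) : R⟦X⟧))
    (hd : (p : R⟦X⟧) ∣ PowerSeries.derivative R S) {i : ℕ} (hi : i < p ^ n) :
    (p : R) ∣ i * c i := by
  set Q : Polynomial R := ∑ i ∈ Finset.range (p ^ n), Polynomial.C (c i) * (1 + Polynomial.X) ^ i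
    with hQ
  have hnat : ∀ m : ℕ, (m : R⟦X⟧) = PowerSeries.C (m : R) := fun m => by simp
  obtain ⟨G, hG⟩ := hS
  obtain ⟨D, hD⟩ := hd
  obtain ⟨W, hW⟩ := exists_add_pow_prime_pow_eq hp (1 : R⟦X⟧) PowerSeries.X n
  have h1 : PowerSeries.derivative R (p ^ n : R⟦X⟧) = 0 := by
    rw [← Nat.cast_pow, hnat]; exact PowerSeries.derivative_C
  have h2 : ∃ E : R⟦X⟧, (Polynomial.derivative Q : R⟦X⟧) = (p : R⟦X⟧) * E - PowerSeries.X ^ p ^ n *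
      PowerSeries.derivative R G := by
    have h3 : (Q : R⟦X⟧) = S - (PowerSeries.X ^ p ^ n + (p : R⟦X⟧) * (PowerSeries.X * W)) * G := by
      have h5 : (Q : R⟦X⟧) = S - ((1 + PowerSeries.X) ^ p ^ n - 1) * G := by
        rw [← hG]; ring
      rw [h5, hW]
      ring
    have h4 : PowerSeries.derivative R (p : R⟦X⟧) = 0 := by
      rw [hnat]; exact PowerSeries.derivative_C
    obtain ⟨m, rfl⟩ := Nat.exists_eq_add_one_of_ne_zero hn
    rw [← PowerSeries.derivative_coe, h3]
    simp only [map_sub, map_add, Derivation.leibniz, PowerSeries.derivative_pow, smul_eq_mul, hD,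
      h4, PowerSeries.derivative_X]
    refine ⟨D - PowerSeries.X * W * PowerSeries.derivative R G - G * (
      PowerSeries.X * PowerSeries.derivative R W + W) - G * ((p : R⟦X⟧) ^ m *
        PowerSeries.X ^ (p ^ (m + 1) - 1)), ?_⟩
    generalize (PowerSeries.X : R⟦X⟧) ^ (p ^ (m + 1) - 1) = Y
    push_cast
    ring
  obtain ⟨E, hE⟩ := h2
  have hdeg : Q.derivative.natDegree < p ^ n := by
    have hpos : 0 < p ^ n := pow_pos hp.pos n
    have : Q.natDegree ≤ p ^ n - 1 := by
      refine Polynomial.natDegree_sum_le_of_forall_le _ _ fun j hj => ?_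
      refine (Polynomial.natDegree_C_mul_le _ _).trans ?_
      refine (Polynomial.natDegree_pow_le).trans ?_
      have h5 : (1 + Polynomial.X : Polynomial R).natDegree ≤ 1 := by
        rw [add_comm, ← Polynomial.C_1]
        exact Polynomial.natDegree_add_C.trans_le Polynomial.natDegree_X_le
      have := Finset.mem_range.1 hj
      calc j * _ ≤ j * 1 := Nat.mul_le_mul_left _ h5
        _ ≤ _ := by omega
    have := Polynomial.natDegree_derivative_le Q
    omega
  have hdvd : Polynomial.C (p : R) ∣ Q.derivative := by
    rw [Polynomial.C_dvd_iff_dvd_coeff]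
    intro j
    rcases lt_or_ge j (p ^ n) with hj | hj
    · rw [← Polynomial.coeff_coe, hE, map_sub, PowerSeries.coeff_X_pow_mul', if_neg (by omega),
        sub_zero, hnat, PowerSeries.coeff_C_mul]
      exact Dvd.intro _ rfl
    · rw [Polynomial.coeff_eq_zero_of_natDegree_lt (by omega)]
      exact dvd_zero _
  have hmul : Polynomial.taylor (-1) ((1 + Polynomial.X) * Q.derivative) =
      ∑ i ∈ Finset.range (p ^ n), Polynomial.C (i * c i) * Polynomial.X ^ i := by
    rw [hQ, Polynomial.derivative_sum, Finset.mul_sum, map_sum]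
    refine Finset.sum_congr rfl fun j _ => ?_
    rw [Polynomial.derivative_C_mul, Polynomial.derivative_pow]
    rcases Nat.eq_zero_or_pos j with rfl | hj
    · simp
    · have h6 : (1 + Polynomial.X : Polynomial R) * (Polynomial.C (c j) *
          (Polynomial.C (j : R) * (1 + Polynomial.X) ^ (j - 1) *
            Polynomial.derivative (1 + Polynomial.X))) =
          Polynomial.C (j * c j) * (1 + Polynomial.X) ^ j := by
        rw [← Nat.sub_add_cancel hj, pow_succ]
        simp
        ring
      rw [h6, Polynomial.taylor_mul, Polynomial.taylor_C, Polynomial.taylor_pow]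
      simp
  have h7 : Polynomial.C (p : R) ∣ ∑ i ∈ Finset.range (p ^ n),
      Polynomial.C (i * c i) * Polynomial.X ^ i := by
    rw [← hmul]
    obtain ⟨A, hA⟩ := hdvd
    rw [hA, Polynomial.taylor_mul, Polynomial.taylor_mul, Polynomial.taylor_C]
    exact ⟨_, mul_left_comm _ _ _⟩
  have h8 := (Polynomial.C_dvd_iff_dvd_coeff _ _).1 h7 i
  rw [Polynomial.finsetSum_coeff] at h8
  simpa only [Polynomial.coeff_C_mul, Polynomial.coeff_X_pow, mul_ite, mul_one, mul_zero,
    Finset.sum_ite_eq, Finset.mem_range, hi, if_true] using h8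

/-- For `g` of order `N`, the kernel of `R[X] → R[⟨g⟩]`, `X ↦ g - 1`, is generated by
`(1 + X)^N - 1`. -/
theorem dvd_of_aeval_eq_zero {G : Type*} [Group G] {g : G} {N : ℕ} (hN : 0 < N) (hg : g ^ N = 1)
    (hinj : ∀ i j, g ^ i = g ^ j → i ≡ j [MOD N]) {D : Polynomial R}
    (hD : Polynomial.aeval (MonoidAlgebra.of R G g - 1) D = 0) :
    ((1 + Polynomial.X) ^ N - 1 : Polynomial R) ∣ D := by
  nontriviality R
  set D' := Polynomial.taylor (-1) D with hD'
  have hDD : D = Polynomial.taylor 1 D' := by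
    rw [hD', Polynomial.taylor_taylor]; simp
  have h1 : Polynomial.aeval (MonoidAlgebra.of R G g) D' = 0 := by
    rw [hD', Polynomial.taylor_apply, Polynomial.aeval_comp]
    simpa [sub_eq_add_neg] using hD
  have hmon : (Polynomial.X ^ N - 1 : Polynomial R).Monic := Polynomial.monic_X_pow_sub_C 1 hN.ne'
  have hr : Polynomial.aeval (MonoidAlgebra.of R G g) (D' %ₘ (Polynomial.X ^ N - 1)) = 0 := by
    rw [Polynomial.modByMonic_eq_sub_mul_div, map_sub, h1, map_mul, map_sub, map_pow,
      Polynomial.aeval_X, ← map_pow, hg, map_one, map_one, sub_self, zero_mul, sub_zero]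
  have hdeg : (D' %ₘ (Polynomial.X ^ N - 1)).natDegree < N := by
    have := Polynomial.natDegree_modByMonic_lt D' hmon (by
      intro h
      have := congrArg Polynomial.natDegree h
      rw [← Polynomial.C_1, Polynomial.natDegree_X_pow_sub_C] at this
      simp at this
      omega)
    rwa [← Polynomial.C_1, Polynomial.natDegree_X_pow_sub_C] at this
  have h0 : D' %ₘ (Polynomial.X ^ N - 1) = 0 := by
    ext i
    rw [Polynomial.coeff_zero]
    rcases lt_or_ge i N with hi | hi
    · rw [Polynomial.aeval_eq_sum_range' hdeg] at hr
      have h2 := congrArg (fun x : MonoidAlgebra R G => x.coeff (g ^ i)) hr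
      simp only [MonoidAlgebra.of_apply, MonoidAlgebra.smul_single, smul_eq_mul,
        mul_one, MonoidAlgebra.coeff_sum, Finsupp.finsetSum_apply, MonoidAlgebra.coeff_single,
        MonoidAlgebra.single_pow, one_pow] at h2
      rw [Finset.sum_eq_single i] at h2
      · simpa using h2
      · intro j hj hji
        exact Finsupp.single_eq_of_ne fun h =>
          hji ((hinj _ _ h.symm).eq_of_lt_of_lt (Finset.mem_range.1 hj) hi)
      · intro h
        exact absurd (Finset.mem_range.2 hi) h
    · exact Polynomial.coeff_eq_zero_of_natDegree_lt (by omega)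
  obtain ⟨E, hE⟩ := (Polynomial.modByMonic_eq_zero_iff_dvd hmon).1 h0
  rw [hDD, hE, Polynomial.taylor_mul]
  refine Dvd.intro (Polynomial.taylor 1 E) ?_
  congr 1
  rw [map_sub, Polynomial.taylor_pow, Polynomial.taylor_X, Polynomial.taylor_one, Polynomial.C_1,
    add_comm]

end Coefficients

/-! ### Existence of Mirimanoff's power series -/

section ExistenceOfMirimanoffSeries

variable {p : ℕ} [Fact p.Prime]

/-- The integers between `1` and `p^{n+1} - 1` prime to `p`. -/
def unitResidues (p n : ℕ) : Finset ℕ :=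
  (Finset.Icc 1 (p ^ (n + 1) - 1)).filter (fun k => ¬ p ∣ k)

theorem mem_unitResidues {n k : ℕ} : k ∈ unitResidues p n ↔ k < p ^ (n + 1) ∧ ¬ p ∣ k := by
  have hpos : 0 < p ^ (n + 1) := pow_pos (Fact.out : p.Prime).pos _
  rw [unitResidues, Finset.mem_filter, Finset.mem_Icc]
  refine ⟨fun h => ⟨by omega, h.2⟩, fun h => ⟨⟨?_, by omega⟩, h.2⟩⟩
  rw [Nat.one_le_iff_ne_zero]
  rintro rfl
  exact h.2 (dvd_zero p)

/-- The sum over residues at level `n + 1` splits into fibres over the residues at level `n`. -/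
theorem sum_unitResidues_succ {M : Type*} [AddCommMonoid M] (n : ℕ) (f : ℕ → M) :
    ∑ k ∈ unitResidues p (n + 1), f k =
      ∑ k ∈ unitResidues p n, ∑ j ∈ Finset.range p, f (k + p ^ (n + 1) * j) := by
  have hpos : 0 < p ^ (n + 1) := pow_pos (Fact.out : p.Prime).pos _
  have hpq : p ∣ p ^ (n + 1) := dvd_pow_self p n.succ_ne_zero
  rw [← Finset.sum_product']
  symm
  refine Finset.sum_nbij' (fun x => x.1 + p ^ (n + 1) * x.2)
    (fun k => (k % p ^ (n + 1), k / p ^ (n + 1))) ?_ ?_ ?_ ?_ ?_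
  · rintro ⟨k, j⟩ h
    simp only [Finset.mem_product, mem_unitResidues, Finset.mem_range] at h ⊢
    refine ⟨?_, fun h1 => h.1.2 ((Nat.dvd_add_left (hpq.mul_right j)).1 h1)⟩
    calc k + p ^ (n + 1) * j < p ^ (n + 1) + p ^ (n + 1) * j := by omega
      _ = p ^ (n + 1) * (j + 1) := by ring
      _ ≤ p ^ (n + 1) * p := Nat.mul_le_mul_left _ h.2
      _ = p ^ (n + 1 + 1) := by ring
  · intro k h
    simp only [Finset.mem_product, mem_unitResidues, Finset.mem_range] at h ⊢
    refine ⟨⟨Nat.mod_lt _ hpos, fun h1 => h.2 ((Nat.dvd_mod_iff hpq).1 h1)⟩, ?_⟩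
    rw [Nat.div_lt_iff_lt_mul hpos]
    calc k < _ := h.1
      _ = _ := by ring
  · rintro ⟨k, j⟩ h
    simp only [Finset.mem_product, mem_unitResidues, Finset.mem_range] at h
    simp [Nat.mod_eq_of_lt h.1.1, Nat.add_mul_div_left _ _ hpos, Nat.div_eq_of_lt h.1.1]
  · intro k _
    exact Nat.mod_add_div _ _
  · intros
    rfl

theorem angle_eq {a ζ : ℤ_[p]} (h : ζ ^ (p - 1) = 1) (ha : (p : ℤ_[p]) ∣ a - ζ) :
    ζ * angle a = a := by
  have h1 : IsUnit ζ := isUnit_of_not_dvd (not_dvd_of_pow_eq_one h)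
  rw [angle, omega_eq h ha, mul_left_comm, Ring.mul_inverse_cancel _ h1, mul_one]

open Classical in
/-- The discrete logarithm of `⟨k⟩` to the base `1 + p` modulo `p^{n+1}`; for `p` odd and `k` prime to
`p` it exists, and the default value `0` is not used. -/
def lg (p : ℕ) [Fact p.Prime] (n k : ℕ) : ℕ :=
  if h : ∃ i < p ^ n, (p : ℤ_[p]) ^ (n + 1) ∣ angle (k : ℤ_[p]) - (1 + p) ^ i then h.choose else 0

theorem natCast_not_dvd {k : ℕ} (hk : ¬ p ∣ k) : ¬ (p : ℤ_[p]) ∣ (k : ℤ_[p]) := fun h =>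
  hk (dvd_natCast_iff.1 h)

theorem dvd_angle_sub_one {a : ℤ_[p]} (ha : ¬ (p : ℤ_[p]) ∣ a) : (p : ℤ_[p]) ∣ angle a - 1 := by
  obtain ⟨ζ, h1, h2⟩ := exists_teichmuller ha
  have h3 : (p : ℤ_[p]) ∣ ζ * (angle a - 1) := by
    rwa [mul_sub, angle_eq h1 h2, mul_one]
  exact (PadicInt.prime_p.dvd_or_dvd h3).resolve_left (not_dvd_of_pow_eq_one h1)

theorem lg_spec (hp2 : p ≠ 2) (n : ℕ) {k : ℕ} (hk : ¬ p ∣ k) :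
    lg p n k < p ^ n ∧ (p : ℤ_[p]) ^ (n + 1) ∣ angle (k : ℤ_[p]) - (1 + p) ^ lg p n k := by
  have h := exists_pow_one_add hp2 (dvd_angle_sub_one (natCast_not_dvd hk)) n
  rw [lg, dif_pos h]
  exact h.choose_spec

theorem gam_eq_pow (hp2 : p ≠ 2) (n : ℕ) {k : ℕ} (hk : ¬ p ∣ k) :
    gam n (k : ℤ_[p]) = gamZero p n ^ lg p n k :=
  gammaElt_eq_pow (lg_spec hp2 n hk).2

theorem lg_congr (hp2 : p ≠ 2) (n : ℕ) {k : ℕ} (hk : ¬ p ∣ k) (j : ℕ) :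
    lg p (n + 1) (k + p ^ (n + 1) * j) ≡ lg p n k [MOD p ^ n] := by
  have hpq : p ∣ p ^ (n + 1) := dvd_pow_self p n.succ_ne_zero
  have hk' : ¬ p ∣ k + p ^ (n + 1) * j := fun h1 => hk ((Nat.dvd_add_left (hpq.mul_right j)).1 h1)
  obtain ⟨ζ, h1, h2⟩ := exists_teichmuller (natCast_not_dvd hk)
  have h3 : (p : ℤ_[p]) ∣ ((k + p ^ (n + 1) * j : ℕ) : ℤ_[p]) - ζ := by
    push_cast
    rw [add_sub_right_comm]
    exact h2.add ((dvd_pow_self _ n.succ_ne_zero).mul_right _)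
  have h4 := angle_eq h1 h2
  have h5 := angle_eq h1 h3
  apply pow_one_add_injective hp2
  have h6 := (pow_dvd_pow (p : ℤ_[p]) (by omega : n + 1 ≤ n + 1 + 1)).trans (lg_spec hp2 (n + 1) hk').2
  have h7 := (lg_spec hp2 n hk).2
  have h8 : (p : ℤ_[p]) ^ (n + 1) ∣ angle ((k + p ^ (n + 1) * j : ℕ) : ℤ_[p]) - angle (k : ℤ_[p]) := by
    have hu : IsUnit ζ := isUnit_of_not_dvd (not_dvd_of_pow_eq_one h1)
    rw [← hu.dvd_mul_left, mul_sub, h4, h5]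
    push_cast
    exact ⟨j, by ring⟩
  have := (h8.sub h6).add h7
  convert this using 1
  ring

variable {L : IntermediateField ℚ_[p] (PadicAlgCl p)}

/-- The character value `θ(k) ω(k)^{-1}`. -/
def DeltaHat.twist (θ : DeltaHat p) (a : ℤ_[p]) : ℤ_[p] :=
  θ.val a * Ring.inverse (omega a)

theorem DeltaHat.twist_congr (θ : DeltaHat p) {a b : ℤ_[p]} (ha : ¬ (p : ℤ_[p]) ∣ a)
    (h : (p : ℤ_[p]) ∣ a - b) : θ.twist a = θ.twist b := by
  obtain ⟨ζ, h1, h2⟩ := exists_teichmuller ha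
  have h3 : (p : ℤ_[p]) ∣ b - ζ := by
    have := h2.sub h
    simpa using this
  rw [DeltaHat.twist, DeltaHat.twist, θ.val_congr h, omega_eq h1 h2, omega_eq h1 h3]

/-- The coefficient of `γ_n(k)` in `M_n(θ, a)`. -/
def termCoeff (θ : DeltaHat p) (a : O L) (n k : ℕ) : O L :=
  a ^ k * Ring.inverse (a ^ p ^ (n + 1) - 1) * algebraMap ℤ_[p] (O L) (θ.twist k)

/-- The polynomial `∑ c_k (1 + X)^{lg k}` corresponding to `M_n(θ, a) = ∑ c_k γ_n(k)`. -/
def levelPoly (θ : DeltaHat p) (a : O L) (n : ℕ) : Polynomial (O L) :=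
  ∑ k ∈ unitResidues p n, Polynomial.C (termCoeff θ a n k) * (1 + Polynomial.X) ^ lg p n k

theorem aeval_sum_one_add_X_pow {R G : Type*} [CommRing R] [Group G] (g : G) (s : Finset ℕ)
    (c : ℕ → R) (f : ℕ → ℕ) :
    Polynomial.aeval (MonoidAlgebra.of R G g - 1)
      (∑ k ∈ s, Polynomial.C (c k) * (1 + Polynomial.X) ^ f k) =
      ∑ k ∈ s, MonoidAlgebra.single (g ^ f k) (c k) := by
  rw [map_sum]
  refine Finset.sum_congr rfl fun k _ => ?_
  rw [map_mul, map_pow, map_add, map_one, Polynomial.aeval_X, add_sub_cancel, ← map_pow,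
    Polynomial.aeval_C, MonoidAlgebra.of_apply, ← Algebra.smul_def,
    MonoidAlgebra.smul_single, smul_eq_mul, mul_one]

theorem aeval_levelPoly (hp2 : p ≠ 2) (θ : DeltaHat p) (a : O L) (n : ℕ) :
    Polynomial.aeval (MonoidAlgebra.of (O L) (Gam p n) (gamZero p n) - 1) (levelPoly θ a n) =
      groupRingElt θ a n := by
  rw [levelPoly, aeval_sum_one_add_X_pow, groupRingElt]
  refine Finset.sum_congr rfl fun k hk => ?_
  rw [← gam_eq_pow hp2 n (mem_unitResidues.1 hk).2]
  rfl

theorem mapsTo_groupRingElt_iff (hp2 : p ≠ 2) (θ : DeltaHat p) (a : O L) (n : ℕ) (F : (O L)⟦X⟧) :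
    MapsTo n F (groupRingElt θ a n) ↔
      ((1 + PowerSeries.X) ^ p ^ n - 1 : (O L)⟦X⟧) ∣ F - (levelPoly θ a n : (O L)⟦X⟧) := by
  constructor
  · rintro ⟨Q, hQ, hx⟩
    have h1 : Polynomial.aeval (MonoidAlgebra.of (O L) (Gam p n) (gamZero p n) - 1)
        (Q - levelPoly θ a n) = 0 := by
      rw [map_sub, hx, aeval_levelPoly hp2, sub_self]
    have h2 := dvd_of_aeval_eq_zero (pow_pos (Fact.out : p.Prime).pos n)
      (gamZero_pow_eq_one hp2 n) (fun i j => gamZero_pow_injective hp2) h1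
    have h3 := map_dvd (Polynomial.coeToPowerSeries.ringHom (R := O L)) h2
    have h4 : ((1 + PowerSeries.X) ^ p ^ n - 1 : (O L)⟦X⟧) ∣
        (Q : (O L)⟦X⟧) - (levelPoly θ a n : (O L)⟦X⟧) := by
      simpa using h3
    simpa using hQ.add h4
  · intro h
    exact ⟨_, h, aeval_levelPoly hp2 θ a n⟩

/-- The distribution relation: summing the geometric series
`∑ a^{k + qj} / (a^{qp} - 1)` gives `a^k / (a^q - 1)`. -/
theorem sum_termCoeff (θ : DeltaHat p) {a : O L}
    (ha : ∀ n, IsUnit (a ^ p ^ (n + 1) - 1)) (n : ℕ) {k : ℕ} (hk : ¬ p ∣ k) :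
    ∑ j ∈ Finset.range p, termCoeff θ a (n + 1) (k + p ^ (n + 1) * j) = termCoeff θ a n k := by
  have h1 : ∀ j, θ.twist ((k + p ^ (n + 1) * j : ℕ) : ℤ_[p]) = θ.twist k := by
    intro j
    refine (θ.twist_congr (natCast_not_dvd hk) ?_).symm
    push_cast
    rw [sub_add_cancel_left, dvd_neg]
    exact (dvd_pow_self _ n.succ_ne_zero).mul_right _
  simp only [termCoeff, h1]
  rw [← Finset.sum_mul, ← Finset.sum_mul]
  congr 1
  have h2 : ∑ j ∈ Finset.range p, a ^ (k + p ^ (n + 1) * j) =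
      a ^ k * ∑ j ∈ Finset.range p, (a ^ p ^ (n + 1)) ^ j := by
    rw [Finset.mul_sum]
    exact Finset.sum_congr rfl fun j _ => by rw [pow_add, pow_mul]
  have h3 := geom_sum_mul (a ^ p ^ (n + 1)) p
  rw [← pow_mul, ← pow_succ] at h3
  rw [h2, mul_assoc, ← h3, Ring.mul_inverse_rev]
  have h4 : IsUnit (∑ j ∈ Finset.range p, (a ^ p ^ (n + 1)) ^ j) := by
    have := ha (n + 1)
    rw [← h3] at this
    exact isUnit_of_mul_isUnit_left this
  rw [mul_left_comm (∑ j ∈ Finset.range p, (a ^ p ^ (n + 1)) ^ j),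
    Ring.mul_inverse_cancel _ h4, mul_one]

/-- The elements `M_n(θ, a)` form a compatible family. -/
theorem dvd_levelPoly_succ_sub (hp2 : p ≠ 2) (θ : DeltaHat p) {a : O L}
    (ha : ∀ n, IsUnit (a ^ p ^ (n + 1) - 1)) (n : ℕ) :
    ((1 + PowerSeries.X) ^ p ^ n - 1 : (O L)⟦X⟧) ∣
      (levelPoly θ a (n + 1) : (O L)⟦X⟧) - (levelPoly θ a n : (O L)⟦X⟧) := by
  have key : ((1 + Polynomial.X) ^ p ^ n - 1 : Polynomial (O L)) ∣
      levelPoly θ a (n + 1) - levelPoly θ a n := by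
    rw [levelPoly, levelPoly, sum_unitResidues_succ, ← Finset.sum_sub_distrib]
    refine Finset.dvd_sum fun k hk => ?_
    have hk' : ¬ p ∣ k := (mem_unitResidues.1 hk).2
    rw [← sum_termCoeff θ ha n hk', map_sum, Finset.sum_mul, ← Finset.sum_sub_distrib]
    refine Finset.dvd_sum fun j _ => ?_
    rw [← mul_sub]
    refine Dvd.dvd.mul_left ?_ _
    have hc := lg_congr hp2 n hk' j
    set Y : Polynomial (O L) := 1 + Polynomial.X
    have hmod : ∀ m : ℕ, Y ^ p ^ n - 1 ∣ Y ^ m - Y ^ (m % p ^ n) := by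
      intro m
      conv_rhs => rw [← Nat.mod_add_div m (p ^ n), pow_add, pow_mul]
      rw [Nat.mod_add_div, ← mul_sub_one]
      exact (sub_one_dvd_pow_sub_one _ _).mul_left _
    have := (hmod (lg p (n + 1) (k + p ^ (n + 1) * j))).sub (hmod (lg p n k))
    rw [show _ % p ^ n = _ % p ^ n from hc] at this
    simpa using this
  simpa using map_dvd (Polynomial.coeToPowerSeries.ringHom (R := O L)) key

theorem not_isUnit_p (L : IntermediateField ℚ_[p] (PadicAlgCl p)) : ¬ IsUnit (p : O L) := by
  intro h
  obtain ⟨u, hu⟩ := h.exists_right_inv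
  have h1 : IsIntegral ℤ_[p] ((u : L)) := u.2
  have h2 : (u : L) = algebraMap ℚ_[p] L ((p : ℚ_[p])⁻¹) := by
    have h3 := congrArg (fun x : O L => (x : L)) hu
    have h4 : (p : L) * (u : L) = 1 := by simpa using h3
    rw [map_inv₀, map_natCast]
    exact eq_inv_of_mul_eq_one_right h4
  rw [h2, isIntegral_algebraMap_iff (algebraMap ℚ_[p] L).injective] at h1
  obtain ⟨y, hy⟩ := IsIntegrallyClosed.isIntegral_iff.1 h1
  have h5 : (p : ℤ_[p]) * y = 1 := by
    apply IsFractionRing.injective ℤ_[p] ℚ_[p]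
    rw [map_mul, hy, map_natCast, map_one]
    exact mul_inv_cancel₀ (by exact_mod_cast (Fact.out : p.Prime).ne_zero)
  exact PadicInt.prime_p.not_isUnit (IsUnit.of_mul_eq_one _ h5)

variable [FiniteDimensional ℚ_[p] L]

theorem separated_O (x : O L) (h : ∀ n : ℕ, (p : O L) ^ n ∣ x) : x = 0 := by
  have : IsNoetherianRing (O L) := IsIntegralClosure.isNoetherianRing ℤ_[p] ℚ_[p] L (O L)
  have h1 := Ideal.iInf_pow_eq_bot_of_isDomain (Ideal.span {(p : O L)}) (by
    rw [Ne, Ideal.span_singleton_eq_top]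
    exact not_isUnit_p L)
  rw [← Ideal.mem_bot, ← h1, Ideal.mem_iInf]
  intro n
  rw [Ideal.span_singleton_pow, Ideal.mem_span_singleton]
  exact h n

theorem compactSpace_O : CompactSpace (O L) := by
  have : Module.Finite ℤ_[p] (O L) := IsIntegralClosure.finite ℤ_[p] ℚ_[p] L (O L)
  obtain ⟨m, s, hs⟩ := Module.Finite.exists_fin (R := ℤ_[p]) (M := O L)
  have hcont : Continuous fun z : Fin m → ℤ_[p] => ∑ i, z i • s i := by
    refine Continuous.subtype_mk (p := fun x : L => x ∈ O L)
      (f := fun z : Fin m → ℤ_[p] => ((∑ i, z i • s i : O L) : L)) ?_ _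
    have h1 : (fun z : Fin m → ℤ_[p] => ((∑ i, z i • s i : O L) : L)) =
        fun z => ∑ i, ((z i : ℚ_[p])) • (s i : L) := by
      funext z
      rw [AddSubmonoidClass.coe_finsetSum]
      refine Finset.sum_congr rfl fun i _ => ?_
      change z i • (s i : L) = _
      rw [← algebraMap_smul ℚ_[p] (z i) (s i : L)]
      rfl
    rw [h1]
    refine continuous_finsetSum _ fun i _ => ?_
    have h2 : Continuous fun z : Fin m → ℤ_[p] => (z i : ℚ_[p]) :=
      PadicInt.isOpenEmbedding_coe.continuous.comp (continuous_apply i)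
    exact h2.smul continuous_const
  refine ⟨?_⟩
  have h2 : Set.range (fun z : Fin m → ℤ_[p] => ∑ i, z i • s i) = Set.univ := by
    rw [Set.eq_univ_iff_forall]
    intro x
    have hx : x ∈ Submodule.span ℤ_[p] (Set.range s) := by rw [hs]; trivial
    exact (Submodule.mem_span_range_iff_exists_fun ℤ_[p]).1 hx
  rw [← h2]
  exact isCompact_range hcont

/-- The defining property of Mirimanoff's power series, with the group ring replaced by polynomials
modulo `ω_n`. -/
theorem dvd_mirimanoff_sub (hp2 : p ≠ 2) (θ : DeltaHat p) {a : O L}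
    (ha : ∀ n, IsUnit (a ^ p ^ (n + 1) - 1)) (n : ℕ) :
    ((1 + PowerSeries.X) ^ p ^ n - 1 : (O L)⟦X⟧) ∣
      mirimanoff θ a - (levelPoly θ a n : (O L)⟦X⟧) := by
  have := compactSpace_O (L := L)
  have h1 := existsUnique_forall_dvd_sub (R := O L) (Fact.out : p.Prime) separated_O
    (dvd_levelPoly_succ_sub hp2 θ ha)
  have h2 : ∃! F : (O L)⟦X⟧, ∀ n, MapsTo n F (groupRingElt θ a n) := by
    simpa only [mapsTo_groupRingElt_iff hp2] using h1
  rw [← mapsTo_groupRingElt_iff hp2, mirimanoff, dif_pos h2]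
  exact h2.choose_spec.1 n

end ExistenceOfMirimanoffSeries

/-! ### Sums over `ℓ`-th roots of unity and the coefficients at finite level -/

section RootsOfUnitySums

variable {R : Type*} [CommRing R] [IsDomain R] {ℓ : ℕ} {ξ : R}

open Classical in
/-- The `ℓ`-th roots of unity other than `1`. -/
def nontrivialRoots (R : Type*) [CommRing R] [IsDomain R] (ℓ : ℕ) : Finset R :=
  (Polynomial.nthRootsFinset ℓ (1 : R)).erase 1

open Classical in
theorem mem_nontrivialRoots (hℓ : 0 < ℓ) {ρ : R} :
    ρ ∈ nontrivialRoots R ℓ ↔ ρ ≠ 1 ∧ ρ ^ ℓ = 1 := by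
  rw [nontrivialRoots, Finset.mem_erase, Polynomial.mem_nthRootsFinset hℓ]

open Classical in
theorem sum_nontrivialRoots_pow_zero (hξ : IsPrimitiveRoot ξ ℓ) (hℓ : 0 < ℓ) :
    ∑ η ∈ nontrivialRoots R ℓ, η ^ 0 = (ℓ : R) - 1 := by
  have h1 : (1 : R) ∈ Polynomial.nthRootsFinset ℓ (1 : R) := by
    rw [Polynomial.mem_nthRootsFinset hℓ, one_pow]
  simp only [pow_zero, Finset.sum_const, nsmul_eq_mul, mul_one, nontrivialRoots]
  rw [Finset.card_erase_of_mem h1, hξ.card_nthRootsFinset, Nat.cast_pred hℓ]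

theorem sum_nontrivialRoots_pow (hξ : IsPrimitiveRoot ξ ℓ) (hℓ : 0 < ℓ) {s : ℕ}
    (hs : ¬ ℓ ∣ s) : ∑ η ∈ nontrivialRoots R ℓ, η ^ s = -1 := by
  have h1 : (1 : R) ∈ Polynomial.nthRootsFinset ℓ (1 : R) := by
    rw [Polynomial.mem_nthRootsFinset hℓ, one_pow]
  have h2 : (ξ ^ s - 1) * ∑ η ∈ Polynomial.nthRootsFinset ℓ (1 : R), η ^ s = 0 := by
    rw [sub_mul, one_mul, Finset.mul_sum, sub_eq_zero]
    have hξ0 : ξ ≠ 0 := hξ.ne_zero hℓ.ne'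
    refine Finset.sum_nbij (fun η => ξ * η) ?_ ?_ ?_ ?_
    · intro η h
      rw [Polynomial.mem_nthRootsFinset hℓ] at h ⊢
      rw [mul_pow, h, hξ.pow_eq_one, one_mul]
    · intro a _ b _ hab
      exact mul_left_cancel₀ hξ0 hab
    · intro η h
      rw [Finset.mem_coe, Polynomial.mem_nthRootsFinset hℓ] at h
      refine ⟨ξ ^ (ℓ - 1) * η, ?_, ?_⟩
      · rw [Finset.mem_coe, Polynomial.mem_nthRootsFinset hℓ, mul_pow, h, ← pow_mul, mul_one,
          mul_comm, pow_mul, hξ.pow_eq_one, one_pow]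
      · change ξ * (ξ ^ (ℓ - 1) * η) = η
        rw [← mul_assoc, ← pow_succ', Nat.sub_add_cancel hℓ, hξ.pow_eq_one, one_mul]
    · intro η _
      rw [mul_pow]
  have h3 : ∑ η ∈ Polynomial.nthRootsFinset ℓ (1 : R), η ^ s = 0 :=
    (mul_eq_zero.1 h2).resolve_left fun h => hs (hξ.dvd_of_pow_eq_one s (sub_eq_zero.1 h))
  classical
  rw [← Finset.add_sum_erase _ _ h1, one_pow] at h3
  rw [nontrivialRoots]
  convert eq_neg_of_add_eq_zero_right h3 using 3

theorem sum_nontrivialRoots_geom (hξ : IsPrimitiveRoot ξ ℓ) (hℓ : 0 < ℓ) {m : ℕ}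
    (hm : m < ℓ) :
    ∑ η ∈ nontrivialRoots R ℓ, ∑ s ∈ Finset.range (m + 1), η ^ s = (ℓ : R) - 1 - m := by
  rw [Finset.sum_comm]
  induction m with
  | zero => rw [zero_add, Finset.sum_range_one, sum_nontrivialRoots_pow_zero hξ hℓ]; simp
  | succ m ih =>
    rw [Finset.sum_range_succ, ih (by omega), sum_nontrivialRoots_pow hξ hℓ
      (fun h => absurd (Nat.le_of_dvd (by omega) h) (by omega))]
    push_cast
    ring

/-- `η - 1` divides `ℓ`, because `1 + η + ⋯ + η^{ℓ-1} = 0`. -/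
theorem isUnit_sub_one (hℓ : IsUnit (ℓ : R)) {η : R} (h1 : η ≠ 1) (h : η ^ ℓ = 1) :
    IsUnit (η - 1) := by
  have h2 : (η - 1) * ∑ i ∈ Finset.range ℓ, η ^ i = 0 := by
    rw [mul_geom_sum, h, sub_self]
  have h3 := (mul_eq_zero.1 h2).resolve_left (sub_ne_zero.2 h1)
  refine isUnit_of_dvd_unit ?_ hℓ
  have h4 : (ℓ : R) = -∑ i ∈ Finset.range ℓ, (η ^ i - 1) := by
    rw [Finset.sum_sub_distrib, h3]
    simp
  rw [h4, dvd_neg]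
  exact Finset.dvd_sum fun i _ => sub_one_dvd_pow_sub_one η i

theorem pow_ne_one_of_coprime {R : Type*} [CommRing R] {ℓ q : ℕ} (hq : q.Coprime ℓ) {ρ : R} (h1 : ρ ≠ 1) (h : ρ ^ ℓ = 1) :
    ρ ^ q ≠ 1 := by
  intro h2
  apply h1
  have h3 := Nat.dvd_gcd (orderOf_dvd_of_pow_eq_one h2) (orderOf_dvd_of_pow_eq_one h)
  rw [hq.gcd_eq_one, Nat.dvd_one, orderOf_eq_one_iff] at h3
  exact h3

theorem sum_nontrivialRoots_comp_pow (hℓ : 0 < ℓ) {q : ℕ} (hq : q.Coprime ℓ) {M : Type*}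
    [AddCommMonoid M] (f : R → M) :
    ∑ ρ ∈ nontrivialRoots R ℓ, f (ρ ^ q) = ∑ η ∈ nontrivialRoots R ℓ, f η := by
  have hmaps : ∀ ρ ∈ nontrivialRoots R ℓ, ρ ^ q ∈ nontrivialRoots R ℓ := by
    intro ρ h
    rw [mem_nontrivialRoots hℓ] at h ⊢
    exact ⟨pow_ne_one_of_coprime hq h.1 h.2, by rw [← pow_mul, mul_comm, pow_mul, h.2, one_pow]⟩
  have hinj : Set.InjOn (fun ρ : R => ρ ^ q) (nontrivialRoots R ℓ) := by
    intro a ha b hb hab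
    rw [Finset.mem_coe, mem_nontrivialRoots hℓ] at ha hb
    obtain ⟨e, -, he⟩ := Nat.exists_mul_mod_eq_one_of_coprime hq
      (lt_of_le_of_ne hℓ (fun h => ha.1 (by simpa [← h] using ha.2)))
    have key : ∀ x : R, x ^ ℓ = 1 → (x ^ q) ^ e = x := by
      intro x hx
      rw [← pow_mul, ← Nat.mod_add_div (q * e) ℓ, he, pow_add, pow_mul, hx, one_pow, pow_one,
        mul_one]
    rw [← key a ha.2, ← key b hb.2, show a ^ q = b ^ q from hab]
  exact Finset.sum_nbij (fun ρ => ρ ^ q) hmaps hinj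
    (Finset.surjOn_of_injOn_of_card_le _ hmaps hinj le_rfl) fun _ _ => rfl

/-- The partial fraction `∑ η^m / (η - 1)` over the nontrivial `ℓ`-th roots of unity depends on
`m = ⌊ℓj/q⌋ + 1` through `-m` only; this is evaluated along `η = ρ^q`, with `ρ^k = η^m`. -/
theorem sum_pow_mul_inverse (hξ : IsPrimitiveRoot ξ ℓ) (hℓ : 0 < ℓ) (hu : IsUnit (ℓ : R)) {q : ℕ}
    (hq : q.Coprime ℓ) {k j : ℕ} (hk0 : 0 < k) (hkq : k < q) (hj : j < q)
    (hd : q ∣ k + ℓ * j) :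
    ∑ ρ ∈ nontrivialRoots R ℓ, ρ ^ k * Ring.inverse (ρ ^ q - 1) =
      (∑ η ∈ nontrivialRoots R ℓ, Ring.inverse (η - 1) + ((ℓ : R) - 1)) -
        ((ℓ * j / q : ℕ) : R) := by
  have hq0 : 0 < q := by omega
  -- `0 < k < q` makes `ℓ * j / q + 1` the exact quotient
  have hm : k + ℓ * j = q * (ℓ * j / q + 1) := by
    obtain ⟨m, hm⟩ := hd
    rw [hm]
    congr 1
    have h1 : q * m ≤ q * (ℓ * j / q + 1) + (q - 1) := by
      have := Nat.lt_mul_div_succ (ℓ * j) hq0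
      omega
    have h2 : q * (ℓ * j / q) < q * m := by
      have := Nat.mul_div_le (ℓ * j) q
      omega
    have h3 := Nat.lt_of_mul_lt_mul_left h2
    have h4 : m < ℓ * j / q + 1 + 1 := by
      apply Nat.lt_of_mul_lt_mul_left (a := q)
      rw [Nat.mul_add q (ℓ * j / q + 1) 1]
      omega
    omega
  have hmℓ : ℓ * j / q < ℓ := by
    rw [Nat.div_lt_iff_lt_mul hq0]
    exact Nat.mul_lt_mul_of_pos_left hj hℓ
  have h1 : ∀ ρ ∈ nontrivialRoots R ℓ, ρ ^ k * Ring.inverse (ρ ^ q - 1) =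
      (fun η : R => η ^ (ℓ * j / q + 1) * Ring.inverse (η - 1)) (ρ ^ q) := by
    intro ρ hρ
    rw [mem_nontrivialRoots hℓ] at hρ
    simp only
    rw [← pow_mul, ← hm, pow_add, pow_mul, hρ.2, one_pow, mul_one]
  rw [Finset.sum_congr rfl h1, sum_nontrivialRoots_comp_pow hℓ hq
    (fun η : R => η ^ (ℓ * j / q + 1) * Ring.inverse (η - 1))]
  have h2 : ∀ η ∈ nontrivialRoots R ℓ, η ^ (ℓ * j / q + 1) * Ring.inverse (η - 1) =
      Ring.inverse (η - 1) + ∑ s ∈ Finset.range (ℓ * j / q + 1), η ^ s := by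
    intro η hη
    rw [mem_nontrivialRoots hℓ] at hη
    have hη' := isUnit_sub_one hu hη.1 hη.2
    apply hη'.mul_right_cancel
    rw [mul_assoc, Ring.inverse_mul_cancel _ hη', add_mul, Ring.inverse_mul_cancel _ hη',
      geom_sum_mul]
    ring
  rw [Finset.sum_congr rfl h2, Finset.sum_add_distrib, sum_nontrivialRoots_geom hξ hℓ hmℓ]
  ring

end RootsOfUnitySums

section LevelCoefficients

variable {p : ℕ} [Fact p.Prime]

/-- The `(p - 1)`-st roots of unity in `ℤ_p`. -/
def teich (p : ℕ) [Fact p.Prime] : Finset ℤ_[p] :=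
  Polynomial.nthRootsFinset (p - 1) (1 : ℤ_[p])

theorem mem_teich {ζ : ℤ_[p]} : ζ ∈ teich p ↔ ζ ^ (p - 1) = 1 := by
  rw [teich, Polynomial.mem_nthRootsFinset]
  exact Nat.sub_pos_of_lt (Fact.out : p.Prime).one_lt

/-- The residues with a given discrete logarithm are the `[ζ u]`, with `ζ` running through the
`(p - 1)`-st roots of unity. -/
theorem sum_unitResidues_lg (hp2 : p ≠ 2) {n i : ℕ} (hi : i < p ^ n) {u : ℤ_[p]}
    (hu : (p : ℤ_[p]) ^ (n + 1) ∣ u - (1 + p) ^ i) {M : Type*} [AddCommMonoid M] (f : ℕ → M) :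
    ∑ k ∈ unitResidues p n with lg p n k = i, f k =
      ∑ ζ ∈ teich p, f ((ζ * u).appr (n + 1)) := by
  have hu1 : (p : ℤ_[p]) ∣ u - 1 := by
    have h2 : (p : ℤ_[p]) ∣ (1 + p) ^ i - 1 := by
      simpa using sub_dvd_pow_sub_pow (1 + (p : ℤ_[p])) 1 i
    simpa using (dvd_of_pow_dvd hu).add h2
  have happr : ∀ ζ : ℤ_[p], (p : ℤ_[p]) ∣ (((ζ * u).appr (n + 1) : ℕ) : ℤ_[p]) - ζ := by
    intro ζ
    have h1 := dvd_of_pow_dvd (dvd_sub_appr (ζ * u) (n + 1))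
    have h2 := (hu1.mul_left ζ).sub h1
    convert h2 using 1
    ring
  symm
  refine Finset.sum_nbij (fun ζ => (ζ * u).appr (n + 1)) ?_ ?_ ?_ (fun _ _ => rfl)
  · intro ζ hζ
    rw [mem_teich] at hζ
    have hk : ¬ p ∣ (ζ * u).appr (n + 1) := by
      intro h
      have h1 := (dvd_natCast_iff.2 h).sub (happr ζ)
      exact not_dvd_of_pow_eq_one hζ (by simpa using h1)
    rw [Finset.mem_filter, mem_unitResidues]
    refine ⟨⟨PadicInt.appr_lt _ _, hk⟩, ?_⟩
    have h1 := angle_eq hζ (happr ζ)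
    obtain ⟨h2, h3⟩ := lg_spec hp2 n hk
    refine (pow_one_add_injective hp2 (n := n) ?_).eq_of_lt_of_lt h2 hi
    have h4 : (p : ℤ_[p]) ^ (n + 1) ∣ u - angle (((ζ * u).appr (n + 1) : ℕ) : ℤ_[p]) := by
      rw [← (isUnit_of_not_dvd (not_dvd_of_pow_eq_one hζ)).dvd_mul_left, mul_sub, h1]
      exact dvd_sub_appr _ _
    have := (hu.sub h4).sub h3
    convert this using 1
    ring
  · intro ζ hζ ζ' hζ' h
    rw [Finset.mem_coe, mem_teich] at hζ hζ'
    refine root_eq_of_dvd_sub hζ hζ' ?_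
    have h1 := happr ζ'
    rw [← show (ζ * u).appr (n + 1) = (ζ' * u).appr (n + 1) from h] at h1
    have := h1.sub (happr ζ)
    simpa using this
  · intro k hk
    rw [Finset.mem_coe, Finset.mem_filter, mem_unitResidues] at hk
    obtain ⟨ζ, h1, h2⟩ := exists_teichmuller (natCast_not_dvd hk.1.2)
    refine ⟨ζ, Finset.mem_coe.2 (mem_teich.2 h1), ?_⟩
    change (ζ * u).appr (n + 1) = k
    rw [← appr_natCast hk.1.1]
    apply appr_eq_of_dvd
    rw [← angle_eq h1 h2, ← mul_sub]
    refine Dvd.dvd.mul_left ?_ _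
    have h3 := (lg_spec hp2 n hk.1.2).2
    rw [hk.2] at h3
    have := hu.sub h3
    simpa using this

variable {L : IntermediateField ℚ_[p] (PadicAlgCl p)}

theorem muMinusOne_eq (ℓ : ℕ) : muMinusOne L ℓ = nontrivialRoots (O L) ℓ := by
  rw [muMinusOne, nontrivialRoots]
  congr!

theorem isUnit_natCast_O {m : ℕ} (h : ¬ p ∣ m) : IsUnit (m : O L) := by
  have h1 := (isUnit_of_not_dvd (natCast_not_dvd h)).map (algebraMap ℤ_[p] (O L))
  rwa [map_natCast] at h1

theorem exists_primitiveRoot_O {ℓ : ℕ} (hℓ : 0 < ℓ)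
    (hL : ∀ z : PadicAlgCl p, z ^ ℓ = 1 → z ∈ L) : ∃ ξ : O L, IsPrimitiveRoot ξ ℓ := by
  have : NeZero ℓ := ⟨hℓ.ne'⟩
  obtain ⟨z, hz⟩ := HasEnoughRootsOfUnity.exists_primitiveRoot (PadicAlgCl p) ℓ
  have hz' : IsPrimitiveRoot (⟨z, hL z hz.pow_eq_one⟩ : L) ℓ := by
    rw [← IsPrimitiveRoot.coe_submonoidClass_iff]
    exact hz
  refine ⟨⟨_, (hz'.isIntegral hℓ).tower_top⟩, ?_⟩
  rw [← IsPrimitiveRoot.coe_submonoidClass_iff]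
  exact hz'

/-- The logarithm of `u` is prime to `p` when `u ≢ 1 mod p²`. -/
theorem not_dvd_log {n i : ℕ} (hn : n ≠ 0) {u : ℤ_[p]}
    (hu : (p : ℤ_[p]) ^ (n + 1) ∣ u - (1 + p) ^ i) (hu2 : ¬ (p : ℤ_[p]) ^ 2 ∣ u - 1) :
    ¬ p ∣ i := by
  rintro ⟨c, rfl⟩
  apply hu2
  have h1 : (p : ℤ_[p]) ^ 2 ∣ (1 + p) ^ (p * c) - 1 := by
    have h2 := dvd_sub_pow_of_dvd_sub (R := ℤ_[p]) (p := p) (a := 1 + p) (b := 1) (by simp) 1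
    rw [one_pow, pow_one] at h2
    rw [pow_mul (1 + (p : ℤ_[p]))]
    exact h2.trans (sub_one_dvd_pow_sub_one _ _)
  have h3 := ((pow_dvd_pow _ (by omega)).trans hu).add h1
  simpa using h3

/-- If the derivative of `∑ M(T, θ, ρ)` vanishes modulo `p`, then so do the coefficients in degrees
not divisible by `p` at all finite levels. -/
theorem dvd_sum_teich [FiniteDimensional ℚ_[p] L] (hp2 : p ≠ 2) (θ : DeltaHat p) {ℓ : ℕ}
    (hℓ : 0 < ℓ) (hpℓ : p.Coprime ℓ) (hL : ∀ z : PadicAlgCl p, z ^ ℓ = 1 → z ∈ L)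
    (hd : (p : (O L)⟦X⟧) ∣ ∑ ρ ∈ muMinusOne L ℓ,
      PowerSeries.derivative (O L) (mirimanoff θ ρ)) :
    ∃ B : O L, ∀ n ≠ 0, ∀ u v : ℤ_[p], u = -(ℓ * v) → (p : ℤ_[p]) ∣ u - 1 →
      ¬ (p : ℤ_[p]) ^ 2 ∣ u - 1 →
      (p : O L) ∣ ∑ ζ ∈ teich p,
        (B - ((ℓ * (ζ * v).appr (n + 1) / p ^ (n + 1) : ℕ) : O L)) *
          algebraMap ℤ_[p] (O L) (θ.twist ζ) := by
  have hp : p.Prime := Fact.out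
  obtain ⟨ξ, hξ⟩ := exists_primitiveRoot_O (L := L) hℓ hL
  have hℓu : IsUnit (ℓ : O L) := isUnit_natCast_O ((hp.coprime_iff_not_dvd).1 hpℓ)
  refine ⟨∑ η ∈ nontrivialRoots (O L) ℓ, Ring.inverse (η - 1) + ((ℓ : O L) - 1),
    fun n hn u v huv hu1 hu2 => ?_⟩
  have hqℓ : (p ^ (n + 1)).Coprime ℓ := hpℓ.pow_left _
  obtain ⟨i, hi, hui⟩ := exists_pow_one_add hp2 hu1 n
  have hpi : ¬ p ∣ i := not_dvd_log hn hui hu2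
  set c : ℕ → O L := fun i => ∑ k ∈ unitResidues p n with lg p n k = i,
    ∑ ρ ∈ muMinusOne L ℓ, termCoeff θ ρ n k with hc
  have hsum : ∑ ρ ∈ muMinusOne L ℓ, levelPoly θ ρ n =
      ∑ i ∈ Finset.range (p ^ n), Polynomial.C (c i) * (1 + Polynomial.X) ^ i := by
    simp only [levelPoly]
    rw [Finset.sum_comm, ← Finset.sum_fiberwise_of_maps_to (s := unitResidues p n)
      (t := Finset.range (p ^ n)) (g := lg p n)
      (fun k hk => Finset.mem_range.2 (lg_spec hp2 n (mem_unitResidues.1 hk).2).1)]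
    refine Finset.sum_congr rfl fun i _ => ?_
    rw [hc, map_sum, Finset.sum_mul]
    refine Finset.sum_congr rfl fun k hk => ?_
    rw [(Finset.mem_filter.1 hk).2, map_sum, Finset.sum_mul]
  have hS : ((1 + PowerSeries.X) ^ p ^ n - 1 : (O L)⟦X⟧) ∣
      (∑ ρ ∈ muMinusOne L ℓ, mirimanoff θ ρ) -
        ((∑ i ∈ Finset.range (p ^ n), Polynomial.C (c i) * (1 + Polynomial.X) ^ i :
          Polynomial (O L)) : (O L)⟦X⟧) := by
    rw [← hsum]
    have h1 : ((∑ ρ ∈ muMinusOne L ℓ, levelPoly θ ρ n : Polynomial (O L)) : (O L)⟦X⟧) =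
        ∑ ρ ∈ muMinusOne L ℓ, (levelPoly θ ρ n : (O L)⟦X⟧) :=
      map_sum (Polynomial.coeToPowerSeries.ringHom (R := O L)) _ _
    rw [h1, ← Finset.sum_sub_distrib]
    refine Finset.dvd_sum fun ρ hρ => dvd_mirimanoff_sub hp2 θ (fun m => ?_) n
    rw [muMinusOne_eq, mem_nontrivialRoots hℓ] at hρ
    refine isUnit_sub_one hℓu (pow_ne_one_of_coprime (hpℓ.pow_left _) hρ.1 hρ.2) ?_
    rw [← pow_mul, mul_comm, pow_mul, hρ.2, one_pow]
  rw [← map_sum] at hd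
  have h1 := dvd_mul_of_dvd_derivative hp hn hS hd hi
  rw [(isUnit_natCast_O hpi).dvd_mul_left, hc] at h1
  simp only at h1
  rw [sum_unitResidues_lg hp2 hi hui] at h1
  convert h1 using 1
  refine Finset.sum_congr rfl fun ζ hζ => ?_
  rw [mem_teich] at hζ
  have hζp := not_dvd_of_pow_eq_one hζ
  have happr : (p : ℤ_[p]) ∣ ζ - (((ζ * u).appr (n + 1) : ℕ) : ℤ_[p]) := by
    have h1 := dvd_of_pow_dvd (dvd_sub_appr (ζ * u) (n + 1))
    have h2 := h1.sub (hu1.mul_left ζ)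
    convert h2 using 1
    ring
  simp only [termCoeff]
  rw [← Finset.sum_mul, ← θ.twist_congr hζp happr]
  congr 1
  rw [muMinusOne_eq]
  symm
  refine sum_pow_mul_inverse hξ hℓ hℓu hqℓ ?_ (PadicInt.appr_lt _ _) (PadicInt.appr_lt _ _) ?_
  · refine Nat.pos_of_ne_zero fun h => hζp ?_
    simpa [h] using happr
  · have h2 : (p : ℤ_[p]) ^ (n + 1) ∣ ((((ζ * u).appr (n + 1) + ℓ * (ζ * v).appr (n + 1) : ℕ) : ℤ) :
        ℤ_[p]) := by
      have h3 := (dvd_sub_appr (ζ * u) (n + 1)).add ((dvd_sub_appr (ζ * v) (n + 1)).mul_left ℓ)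
      rw [← dvd_neg]
      convert h3 using 1
      rw [huv]
      push_cast
      ring
    rw [PadicInt.pow_p_dvd_int_iff] at h2
    exact_mod_cast h2

end LevelCoefficients

/-! ### Simultaneous approximation by `p`-adic fractional parts -/

section Equidistribution

variable {p : ℕ} [Fact p.Prime]

/-- The additive character `z ↦ exp(2πi z / p^n)` of `ℤ_p`. -/
def padicChar (p : ℕ) [Fact p.Prime] (n : ℕ) : AddChar ℤ_[p] ℂ :=
  haveI : NeZero (p ^ n) := ⟨pow_ne_zero _ (Fact.out : p.Prime).ne_zero⟩
  (ZMod.stdAddChar (N := p ^ n)).compAddMonoidHom (PadicInt.toZModPow n).toAddMonoidHom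

theorem padicChar_eq_exp (n : ℕ) (z : ℤ_[p]) :
    padicChar p n z = Complex.exp (2 * Real.pi * Complex.I * ((z.appr n : ℝ) / p ^ n : ℝ)) := by
  have : NeZero (p ^ n) := ⟨pow_ne_zero _ (Fact.out : p.Prime).ne_zero⟩
  have h1 : PadicInt.toZModPow n z = ((z.appr n : ℤ) : ZMod (p ^ n)) := by
    rw [Int.cast_natCast]; rfl
  change ZMod.stdAddChar (PadicInt.toZModPow n z) = _
  rw [h1, ZMod.stdAddChar_coe]
  congr 1
  push_cast
  ring

theorem toZModPow_eq_zero_iff {n : ℕ} {z : ℤ_[p]} :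
    PadicInt.toZModPow n z = 0 ↔ (p : ℤ_[p]) ^ n ∣ z := by
  rw [← RingHom.mem_ker, PadicInt.ker_toZModPow, Ideal.mem_span_singleton]

theorem sum_padicChar_mul {n : ℕ} {b : ℤ_[p]} (h : ¬ (p : ℤ_[p]) ^ n ∣ b) :
    ∑ w ∈ Finset.range (p ^ n), padicChar p n (w * b) = 0 := by
  have : NeZero (p ^ n) := ⟨pow_ne_zero _ (Fact.out : p.Prime).ne_zero⟩
  have h1 := AddChar.sum_mulShift (PadicInt.toZModPow n b) (ZMod.isPrimitive_stdAddChar (p ^ n))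
  rw [if_neg (fun h2 => h (toZModPow_eq_zero_iff.1 h2)), Nat.cast_zero] at h1
  rw [← h1]
  refine Finset.sum_bij' (fun w _ => (w : ZMod (p ^ n))) (fun w _ => w.val) (fun _ _ => by simp)
    (fun w _ => Finset.mem_range.2 (ZMod.val_lt w))
    (fun w hw => ZMod.val_cast_of_lt (Finset.mem_range.1 hw)) (fun w _ => by simp) ?_
  intro w _
  change ZMod.stdAddChar (PadicInt.toZModPow n ((w : ℤ_[p]) * b)) = _
  rw [map_mul, map_natCast]

theorem padicChar_sum (n : ℕ) {ι : Type*} (s : Finset ι) (f : ι → ℤ_[p]) :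
    padicChar p n (∑ i ∈ s, f i) = ∏ i ∈ s, padicChar p n (f i) := by
  induction s using Finset.cons_induction with
  | empty => simp
  | cons i s hi ih => rw [Finset.sum_cons, Finset.prod_cons, AddChar.map_add_eq_mul, ih]

theorem norm_one_add_exp (y : ℝ) :
    ‖1 + Complex.exp (2 * Real.pi * Complex.I * (y : ℝ))‖ = 2 * |Real.cos (Real.pi * y)| := by
  have h1 : 1 + Complex.exp (2 * Real.pi * Complex.I * (y : ℝ)) =
      Complex.exp (((Real.pi * y : ℝ) : ℂ) * Complex.I) * (2 * ((Real.cos (Real.pi * y) : ℝ) : ℂ)) := by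
    rw [Complex.ofReal_cos, Complex.two_cos, mul_add, ← Complex.exp_add, ← Complex.exp_add, add_comm]
    congr 1
    · congr 1
      push_cast
      ring
    · rw [← Complex.exp_zero]
      congr 1
      push_cast
      ring
  rw [h1, norm_mul, Complex.norm_exp_ofReal_mul_I, one_mul, norm_mul, Complex.norm_real,
    Real.norm_eq_abs]
  simp

/-- If `y` has distance at least `δ` from the integers, then `|1 + exp(2πiy)|² ≤ 4 (1 - 4δ²)`. -/
theorem norm_one_add_exp_sq_le {y δ : ℝ} (hδ : 0 ≤ δ) (h : ∀ m : ℤ, δ ≤ |y - m|) :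
    ‖1 + Complex.exp (2 * Real.pi * Complex.I * (y : ℝ))‖ ^ 2 ≤ 4 * (1 - 4 * δ ^ 2) := by
  have h1 : |Real.cos (Real.pi * y)| = |Real.cos (Real.pi * (y - round y))| := by
    rw [mul_sub, mul_comm Real.pi (round y : ℝ), Real.cos_sub_int_mul_pi, abs_mul, abs_zpow,
      abs_neg, abs_one, one_zpow, one_mul]
  have h2 := h (round y)
  have h3 := abs_sub_round y
  set x := y - round y
  have hpi := Real.pi_pos
  have h4 : |Real.pi * x| = Real.pi * |x| := by rw [abs_mul, abs_of_pos hpi]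
  have h5 := Real.mul_abs_le_abs_sin (x := Real.pi * x) (by rw [h4]; nlinarith)
  have h6 : 2 / Real.pi * |Real.pi * x| = 2 * |x| := by
    rw [h4]; field_simp
  rw [h6] at h5
  have h7 : (2 * δ) ^ 2 ≤ Real.sin (Real.pi * x) ^ 2 := by
    rw [← sq_abs (Real.sin _)]
    exact pow_le_pow_left₀ (by positivity) (by linarith) 2
  rw [norm_one_add_exp, h1, mul_pow, sq_abs]
  have := Real.sin_sq_add_cos_sq (Real.pi * x)
  nlinarith

theorem eventually_not_pow_dvd {z : ℤ_[p]} (hz : z ≠ 0) :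
    ∀ᶠ n : ℕ in Filter.atTop, ¬ (p : ℤ_[p]) ^ n ∣ z := by
  obtain ⟨m, hm⟩ := (FiniteMultiplicity.of_prime_left PadicInt.prime_p hz :
    FiniteMultiplicity (p : ℤ_[p]) z)
  filter_upwards [Filter.eventually_ge_atTop (m + 1)] with n hn h
  exact hm ((pow_dvd_pow _ hn).trans h)

variable {ι : Type*} [Fintype ι] [DecidableEq ι]

/-- Averaging the trigonometric polynomial `∏ z_i^{-M} (1 + z_i)^{2M}` over a residue class modulo
`p^d`: only the frequencies which are linear relations between the `x_i` contribute, and these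
contribute their (positive) coefficients. -/
theorem sum_kernel (x : ι → ℤ_[p]) (t : ι → ℝ)
    (ht : ∀ k : ι → ℤ, ∑ i, (k i : ℤ_[p]) * x i = 0 → ∑ i, (k i : ℝ) * t i = 0)
    (a : ℤ_[p]) (d M n : ℕ)
    (hn : ∀ f ∈ Fintype.piFinset fun _ : ι => Finset.range (2 * M + 1),
      (p : ℤ_[p]) ^ n ∣ p ^ d * ∑ i, (((f i : ℤ) - M : ℤ) : ℤ_[p]) * x i →
        ∑ i, (((f i : ℤ) - M : ℤ) : ℤ_[p]) * x i = 0) :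
    ∑ w ∈ Finset.range (p ^ n), ∏ i,
      (padicChar p n (x i * (a + p ^ d * w)) * Complex.exp (2 * Real.pi * Complex.I * (-t i : ℝ))) ^
        (-(M : ℤ)) *
      (1 + padicChar p n (x i * (a + p ^ d * w)) *
        Complex.exp (2 * Real.pi * Complex.I * (-t i : ℝ))) ^ (2 * M) =
    (p ^ n : ℕ) * ∑ f ∈ Fintype.piFinset fun _ : ι => Finset.range (2 * M + 1),
      open Classical in if ∑ i, (((f i : ℤ) - M : ℤ) : ℤ_[p]) * x i = 0 then
        ((∏ i, (2 * M).choose (f i) : ℕ) : ℂ) else 0 := by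
  have hz0 : ∀ (i : ι) (w : ℤ_[p]), padicChar p n w *
      Complex.exp (2 * Real.pi * Complex.I * (-t i : ℝ)) ≠ 0 := fun i w =>
    mul_ne_zero ((padicChar p n).val_isUnit w).ne_zero (Complex.exp_ne_zero _)
  have hexp : ∀ z : ℂ, z ≠ 0 → z ^ (-(M : ℤ)) * (1 + z) ^ (2 * M) =
      ∑ j ∈ Finset.range (2 * M + 1), ((2 * M).choose j : ℂ) * z ^ ((j : ℤ) - M) := by
    intro z hz
    rw [add_comm, add_pow, Finset.mul_sum]
    refine Finset.sum_congr rfl fun j _ => ?_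
    rw [one_pow, mul_one, ← mul_assoc, mul_comm, sub_eq_neg_add, zpow_add₀ hz, zpow_natCast]
  have hphase : ∀ (f : ι → ℕ) (w : ℤ_[p]), ∏ i, (padicChar p n (x i * w) *
      Complex.exp (2 * Real.pi * Complex.I * (-t i : ℝ))) ^ ((f i : ℤ) - M) =
      padicChar p n ((∑ i, (((f i : ℤ) - M : ℤ) : ℤ_[p]) * x i) * w) *
        Complex.exp (2 * Real.pi * Complex.I * (-∑ i, (((f i : ℤ) - M : ℤ) : ℝ) * t i : ℝ)) := by
    intro f w
    simp_rw [mul_zpow]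
    rw [Finset.prod_mul_distrib]
    congr 1
    · rw [Finset.sum_mul, padicChar_sum]
      refine Finset.prod_congr rfl fun i _ => ?_
      rw [← AddChar.map_zsmul_eq_zpow, zsmul_eq_mul, mul_assoc]
    · simp_rw [← Complex.exp_int_mul]
      rw [← Complex.exp_sum]
      congr 1
      push_cast
      rw [mul_neg, Finset.mul_sum, ← Finset.sum_neg_distrib]
      exact Finset.sum_congr rfl fun i _ => by ring
  have h1 : ∀ w : ℕ, ∏ i, (padicChar p n (x i * (a + p ^ d * w)) *
        Complex.exp (2 * Real.pi * Complex.I * (-t i : ℝ))) ^ (-(M : ℤ)) *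
      (1 + padicChar p n (x i * (a + p ^ d * w)) *
        Complex.exp (2 * Real.pi * Complex.I * (-t i : ℝ))) ^ (2 * M) =
      ∑ f ∈ Fintype.piFinset fun _ : ι => Finset.range (2 * M + 1),
        ((∏ i, (2 * M).choose (f i) : ℕ) : ℂ) *
        (padicChar p n ((∑ i, (((f i : ℤ) - M : ℤ) : ℤ_[p]) * x i) * (a + p ^ d * w)) *
        Complex.exp (2 * Real.pi * Complex.I * (-∑ i, (((f i : ℤ) - M : ℤ) : ℝ) * t i : ℝ))) := by
    intro w
    rw [Finset.prod_congr rfl fun i _ => hexp _ (hz0 i _), Finset.prod_univ_sum]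
    refine Finset.sum_congr rfl fun f _ => ?_
    rw [Finset.prod_mul_distrib, hphase, Nat.cast_prod]
  rw [Finset.sum_congr rfl fun w _ => h1 w, Finset.sum_comm, Finset.mul_sum]
  refine Finset.sum_congr rfl fun f hf => ?_
  rw [← Finset.mul_sum, ← Finset.sum_mul]
  split_ifs with h0
  · rw [h0, ht _ h0]
    simp [mul_comm]
  · have h2 : ∑ w ∈ Finset.range (p ^ n),
        padicChar p n ((∑ i, (((f i : ℤ) - M : ℤ) : ℤ_[p]) * x i) * (a + p ^ d * w)) = 0 := by
      have h3 := sum_padicChar_mul (p := p) (n := n) (fun h => h0 (hn f hf h))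
      rw [← mul_zero (padicChar p n ((∑ i, (((f i : ℤ) - M : ℤ) : ℤ_[p]) * x i) * a)), ← h3,
        Finset.mul_sum]
      refine Finset.sum_congr rfl fun w _ => ?_
      rw [← AddChar.map_add_eq_mul]
      congr 1
      ring
    rw [h2]
    ring

/-- Some value of the trigonometric polynomial is at least its average, hence at least its constant
term. -/
theorem exists_le_prod_norm (x : ι → ℤ_[p]) (t : ι → ℝ)
    (ht : ∀ k : ι → ℤ, ∑ i, (k i : ℤ_[p]) * x i = 0 → ∑ i, (k i : ℝ) * t i = 0)
    (a : ℤ_[p]) (d M : ℕ) :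
    ∀ᶠ n : ℕ in Filter.atTop, ∃ w : ℕ,
      ((2 * M).choose M : ℝ) ^ Fintype.card ι ≤ ∏ i, ‖1 + padicChar p n (x i * (a + p ^ d * w)) *
        Complex.exp (2 * Real.pi * Complex.I * (-t i : ℝ))‖ ^ (2 * M) := by
  have hev : ∀ᶠ n : ℕ in Filter.atTop, ∀ f ∈ Fintype.piFinset fun _ : ι => Finset.range (2 * M + 1),
      (p : ℤ_[p]) ^ n ∣ p ^ d * ∑ i, (((f i : ℤ) - M : ℤ) : ℤ_[p]) * x i →
        ∑ i, (((f i : ℤ) - M : ℤ) : ℤ_[p]) * x i = 0 := by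
    rw [Filter.eventually_all_finset]
    intro f _
    by_cases h0 : ∑ i, (((f i : ℤ) - M : ℤ) : ℤ_[p]) * x i = 0
    · exact Filter.Eventually.of_forall fun _ _ => h0
    · have h1 : (p : ℤ_[p]) ^ d * ∑ i, (((f i : ℤ) - M : ℤ) : ℤ_[p]) * x i ≠ 0 :=
        mul_ne_zero (pow_ne_zero _ PadicInt.prime_p.ne_zero) h0
      filter_upwards [eventually_not_pow_dvd h1] with n hn h
      exact absurd h hn
  filter_upwards [hev] with n hn
  have hsum := sum_kernel x t ht a d M n hn
  by_contra! hlt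
  have hpos : 0 < p ^ n := pow_pos (Fact.out : p.Prime).pos n
  set A : ℕ := ∑ f ∈ Fintype.piFinset fun _ : ι => Finset.range (2 * M + 1),
      open Classical in if ∑ i, (((f i : ℤ) - M : ℤ) : ℤ_[p]) * x i = 0 then
        ∏ i, (2 * M).choose (f i) else 0 with hA
  have hA1 : ((2 * M).choose M) ^ Fintype.card ι ≤ A := by
    have h1 : (fun _ : ι => M) ∈ Fintype.piFinset fun _ : ι => Finset.range (2 * M + 1) := by
      rw [Fintype.mem_piFinset]
      intro i
      rw [Finset.mem_range]
      omega
    refine le_trans (le_of_eq ?_) (Finset.single_le_sum (fun _ _ => Nat.zero_le _) h1)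
    simp
  have hsum' := congrArg norm hsum
  have hAC : (A : ℂ) = ∑ f ∈ Fintype.piFinset fun _ : ι => Finset.range (2 * M + 1),
      open Classical in if ∑ i, (((f i : ℤ) - M : ℤ) : ℤ_[p]) * x i = 0 then
        ((∏ i, (2 * M).choose (f i) : ℕ) : ℂ) else 0 := by
    rw [hA, Nat.cast_sum]
    exact Finset.sum_congr rfl fun f _ => by split_ifs <;> simp
  rw [← hAC, norm_mul, Complex.norm_natCast, Complex.norm_natCast] at hsum'
  have hlt' : ‖∑ w ∈ Finset.range (p ^ n), ∏ i,
      (padicChar p n (x i * (a + p ^ d * w)) * Complex.exp (2 * Real.pi * Complex.I * (-t i : ℝ))) ^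
        (-(M : ℤ)) *
      (1 + padicChar p n (x i * (a + p ^ d * w)) *
        Complex.exp (2 * Real.pi * Complex.I * (-t i : ℝ))) ^ (2 * M)‖ <
      ∑ w ∈ Finset.range (p ^ n), ((2 * M).choose M : ℝ) ^ Fintype.card ι := by
    refine (norm_sum_le _ _).trans_lt (Finset.sum_lt_sum_of_nonempty
      (Finset.nonempty_range_iff.2 hpos.ne') fun w _ => ?_)
    refine lt_of_le_of_lt (le_of_eq ?_) (hlt w)
    rw [norm_prod]
    refine Finset.prod_congr rfl fun i _ => ?_
    have h1 : ‖padicChar p n (x i * (a + p ^ d * w)) *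
        Complex.exp (2 * Real.pi * Complex.I * (-t i : ℝ))‖ = 1 := by
      rw [padicChar_eq_exp, norm_mul, mul_right_comm, mul_right_comm _ Complex.I, ]
      have h2 : ∀ y : ℝ, ‖Complex.exp (2 * Real.pi * (y : ℝ) * Complex.I)‖ = 1 := by
        intro y
        have := Complex.norm_exp_ofReal_mul_I (2 * Real.pi * y)
        push_cast at this ⊢
        exact this
      rw [h2, h2, one_mul]
    rw [norm_mul, norm_zpow, h1, one_zpow, one_mul, norm_pow]
  rw [hsum', Finset.sum_const, Finset.card_range, nsmul_eq_mul] at hlt'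
  have h2 := lt_of_mul_lt_mul_left hlt' (by positivity)
  have h3 : (((2 * M).choose M : ℝ)) ^ Fintype.card ι ≤ A := by exact_mod_cast hA1
  linarith

/-- Kronecker–Weyl approximation for `p`-adic integers: if the real numbers `t_i` satisfy all
integral linear relations between the `x_i ∈ ℤ_p`, then `[x_i v] / p^n` comes arbitrarily close to
`t_i` modulo `1`, simultaneously in `i`, for suitable `v` in any given residue class. -/
theorem eventually_exists_close (x : ι → ℤ_[p]) (t : ι → ℝ)
    (ht : ∀ k : ι → ℤ, ∑ i, (k i : ℤ_[p]) * x i = 0 → ∑ i, (k i : ℝ) * t i = 0)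
    (a : ℤ_[p]) (d : ℕ) {δ : ℝ} (hδ : 0 < δ) :
    ∀ᶠ n : ℕ in Filter.atTop, ∃ v : ℤ_[p], (p : ℤ_[p]) ^ d ∣ v - a ∧
      ∀ i, ∃ m : ℤ, |((x i * v).appr n : ℝ) / p ^ n - t i - m| < δ := by
  wlog hδ4 : δ ≤ 1 / 4 generalizing δ
  · filter_upwards [this (δ := 1 / 4) (by norm_num) le_rfl] with n hn
    obtain ⟨v, hv, h⟩ := hn
    refine ⟨v, hv, fun i => ?_⟩
    obtain ⟨m, hm⟩ := h i
    exact ⟨m, hm.trans (not_le.1 hδ4)⟩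
  set c : ℝ := 1 - 4 * δ ^ 2 with hc
  have hc0 : 0 ≤ c := by nlinarith
  have hc1 : c < 1 := by nlinarith
  set r := Fintype.card ι
  -- if one factor is at most `4 ^ M * c ^ M`, the product falls below the central term `C(2M, M) ^ r`
  -- once `M` is large, since `C(2M, M) ≥ 4 ^ M / (2 * M)`
  obtain ⟨M, hM0, hM⟩ : ∃ M : ℕ, 0 < M ∧ (2 : ℝ) ^ r * ((M : ℝ) ^ r * c ^ M) < 1 := by
    have h1 := (tendsto_pow_const_mul_const_pow_of_lt_one r hc0 hc1).const_mul ((2 : ℝ) ^ r)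
    rw [mul_zero] at h1
    obtain ⟨M, hM1, hM2⟩ := ((h1.eventually_lt_const (by norm_num : (0 : ℝ) < 1)).and
      (Filter.eventually_gt_atTop 0)).exists
    exact ⟨M, hM2, hM1⟩
  filter_upwards [exists_le_prod_norm x t ht a d M] with n hn
  obtain ⟨w, hw⟩ := hn
  refine ⟨a + p ^ d * w, by simp, fun i => ?_⟩
  by_contra! hfar
  have hz : ∀ j, padicChar p n (x j * (a + p ^ d * w)) *
      Complex.exp (2 * Real.pi * Complex.I * (-t j : ℝ)) =
      Complex.exp (2 * Real.pi * Complex.I *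
        (((x j * (a + p ^ d * w)).appr n : ℝ) / p ^ n - t j : ℝ)) := by
    intro j
    rw [padicChar_eq_exp, ← Complex.exp_add]
    congr 1
    push_cast
    ring
  simp_rw [hz] at hw
  have hle : ∀ j, ‖1 + Complex.exp (2 * Real.pi * Complex.I *
      (((x j * (a + p ^ d * w)).appr n : ℝ) / p ^ n - t j : ℝ))‖ ^ (2 * M) ≤
      4 ^ M * (if j = i then c ^ M else 1) := by
    intro j
    rw [pow_mul]
    split_ifs with hj
    · subst hj
      rw [← mul_pow]
      exact pow_le_pow_left₀ (by positivity) (norm_one_add_exp_sq_le hδ.le hfar) M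
    · rw [mul_one]
      refine pow_le_pow_left₀ (by positivity) ?_ M
      rw [norm_one_add_exp, mul_pow, sq_abs]
      nlinarith [Real.cos_sq_le_one (Real.pi * (((x j * (a + p ^ d * w)).appr n : ℝ) / p ^ n - t j))]
  have h1 := hw.trans (Finset.prod_le_prod (fun j _ => by positivity) fun j _ => hle j)
  rw [Finset.prod_mul_distrib, Finset.prod_const, Finset.card_univ,
    Finset.prod_ite_eq' Finset.univ i, if_pos (Finset.mem_univ i)] at h1
  have h2 : (4 : ℝ) ^ M ≤ 2 * M * (2 * M).choose M := by
    exact_mod_cast Nat.four_pow_le_two_mul_self_mul_centralBinom M hM0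
  have h3 : ((4 : ℝ) ^ M) ^ r ≤ (2 * M) ^ r * ((2 * M).choose M : ℝ) ^ r := by
    rw [← mul_pow]
    exact pow_le_pow_left₀ (by positivity) h2 r
  have h4 : ((4 : ℝ) ^ M) ^ r ≤ ((4 : ℝ) ^ M) ^ r * ((2 : ℝ) ^ r * ((M : ℝ) ^ r * c ^ M)) :=
    calc ((4 : ℝ) ^ M) ^ r ≤ (2 * M) ^ r * ((2 * M).choose M : ℝ) ^ r := h3
      _ ≤ (2 * M) ^ r * (((4 : ℝ) ^ M) ^ r * c ^ M) := by gcongr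
      _ = _ := by rw [mul_pow]; ring
  have h5 : (0 : ℝ) < ((4 : ℝ) ^ M) ^ r := by positivity
  nlinarith

end Equidistribution

/-! ### Crossing a single wall -/

section LinearFunctional

variable {p : ℕ} [Fact p.Prime]

/-- A real-valued function on the `(p-1)`-st roots of unity which satisfies all integral linear
relations between them, and whose only integral values are those at `±1`. It is the combination `Re + τ Im` of the real and
imaginary part of a complex embedding, for generic `τ`. -/
theorem exists_generic_functional (p : ℕ) [Fact p.Prime] :
    ∃ lam : teich p → ℝ,
      (∀ k : teich p → ℤ, ∑ ζ, (k ζ : ℤ_[p]) * (ζ : ℤ_[p]) = 0 → ∑ ζ, (k ζ : ℝ) * lam ζ = 0) ∧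
      (∀ ζ : teich p, (ζ : ℤ_[p]) = 1 → lam ζ = 1) ∧
      (∀ ζ : teich p, (ζ : ℤ_[p]) = -1 → lam ζ = -1) ∧
      ∀ ζ : teich p, (ζ : ℤ_[p]) ≠ 1 → (ζ : ℤ_[p]) ≠ -1 → ∀ m : ℤ, lam ζ ≠ m := by
  have hp1 : p - 1 ≠ 0 := Nat.sub_ne_zero_of_lt (Fact.out : p.Prime).one_lt
  have hpow : ∀ ζ : teich p, ((ζ : ℤ_[p]) : ℚ_[p]) ^ (p - 1) = 1 := by
    intro ζ
    rw [← PadicInt.coe_pow, mem_teich.1 ζ.2, PadicInt.coe_one]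
  have halg : ∀ ζ : teich p, ((ζ : ℤ_[p]) : ℚ_[p]) ∈ algebraicClosure ℚ ℚ_[p] := by
    intro ζ
    rw [mem_algebraicClosure_iff]
    exact (IsIntegral.of_pow (Nat.pos_of_ne_zero hp1) (by rw [hpow]; exact isIntegral_one)).isAlgebraic
  have : Algebra.IsAlgebraic ℚ (algebraicClosure ℚ ℚ_[p]) := algebraicClosure.isAlgebraic ℚ ℚ_[p]
  let φ : algebraicClosure ℚ ℚ_[p] →ₐ[ℚ] ℂ := IsAlgClosed.lift
  have hφ : Function.Injective φ := φ.injective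
  let s : teich p → ℂ := fun ζ => φ ⟨_, halg ζ⟩
  have hs : ∀ ζ, s ζ ^ (p - 1) = 1 := by
    intro ζ
    simp only [s]
    rw [← map_pow, ← map_one φ]
    congr 1
    exact Subtype.ext (hpow ζ)
  have hs1 : ∀ ζ : teich p, (ζ : ℤ_[p]) = 1 ↔ s ζ = 1 := by
    intro ζ
    simp only [s]
    rw [← map_one φ, hφ.eq_iff, ← Subtype.coe_inj]
    exact ⟨fun h => congrArg (fun z : ℤ_[p] => (z : ℚ_[p])) h, fun h => PadicInt.ext h⟩
  have hs2 : ∀ ζ : teich p, (ζ : ℤ_[p]) = -1 ↔ s ζ = -1 := by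
    intro ζ
    simp only [s]
    rw [← map_one φ, ← map_neg φ, hφ.eq_iff, ← Subtype.coe_inj]
    exact ⟨fun h => congrArg (fun z : ℤ_[p] => (z : ℚ_[p])) h, fun h => PadicInt.ext h⟩
  have him : ∀ ζ : teich p, (ζ : ℤ_[p]) ≠ 1 → (ζ : ℤ_[p]) ≠ -1 → (s ζ).im ≠ 0 := by
    intro ζ h1 h2 h0
    have hn : ‖s ζ‖ = 1 := Complex.norm_eq_one_of_pow_eq_one (hs ζ) hp1
    have h3 : (s ζ).re * (s ζ).re = 1 := by
      have := Complex.normSq_eq_norm_sq (s ζ)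
      rw [hn, Complex.normSq_apply, h0] at this
      simpa using this
    rcases mul_self_eq_one_iff.1 h3 with h | h
    · exact h1 ((hs1 ζ).2 (Complex.ext (by simpa using h) (by simpa using h0)))
    · exact h2 ((hs2 ζ).2 (Complex.ext (by simpa using h) (by simpa using h0)))
  -- each `ζ ≠ ±1` and each integer excludes a single value of `τ`
  obtain ⟨τ, hτ⟩ : ∃ τ : ℝ, τ ∉ ⋃ (ζ : teich p) (m : ℤ), {((m : ℝ) - (s ζ).re) / (s ζ).im} := by
    have hc : (⋃ (ζ : teich p) (m : ℤ), {((m : ℝ) - (s ζ).re) / (s ζ).im}).Countable :=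
      Set.countable_iUnion fun ζ => Set.countable_iUnion fun m => Set.countable_singleton _
    by_contra! h
    exact Cardinal.not_countable_real (hc.mono fun x _ => h x)
  refine ⟨fun ζ => (s ζ).re + τ * (s ζ).im, ?_, ?_, ?_, ?_⟩
  · intro k hk
    have h1 : ∑ ζ, (k ζ : ℂ) * s ζ = 0 := by
      have h2 : ∑ ζ : teich p, (k ζ : algebraicClosure ℚ ℚ_[p]) * ⟨_, halg ζ⟩ = 0 := by
        apply Subtype.ext
        have h3 := congrArg (fun z : ℤ_[p] => (z : ℚ_[p])) hk
        simp only [PadicInt.coe_sum, PadicInt.coe_mul, PadicInt.coe_intCast,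
          PadicInt.coe_zero] at h3
        rw [AddSubmonoidClass.coe_finsetSum]
        simpa using h3
      have h4 := congrArg φ h2
      rw [map_sum, map_zero] at h4
      rw [← h4]
      exact Finset.sum_congr rfl fun ζ _ => by rw [map_mul, map_intCast]
    have hre := congrArg Complex.re h1
    have hi := congrArg Complex.im h1
    simp only [Complex.re_sum, Complex.im_sum, Complex.mul_re, Complex.mul_im, Complex.intCast_re,
      Complex.intCast_im, zero_mul, sub_zero, add_zero, Complex.zero_re, Complex.zero_im] at hre hi
    calc ∑ ζ, (k ζ : ℝ) * ((s ζ).re + τ * (s ζ).im) =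
        ∑ ζ, (k ζ : ℝ) * (s ζ).re + τ * ∑ ζ, (k ζ : ℝ) * (s ζ).im := by
          rw [Finset.mul_sum, ← Finset.sum_add_distrib]
          exact Finset.sum_congr rfl fun ζ _ => by ring
      _ = 0 := by rw [hre, hi]; ring
  · intro ζ h
    simp [(hs1 ζ).1 h]
  · intro ζ h
    simp [(hs2 ζ).1 h]
  · intro ζ h1 h2 m h
    apply hτ
    rw [Set.mem_iUnion]
    refine ⟨ζ, Set.mem_iUnion.2 ⟨m, ?_⟩⟩
    rw [Set.mem_singleton_iff, eq_div_iff (him ζ h1 h2)]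
    linarith

/-- `⌊ℓ y⌋` is locally constant in `y` modulo `1`, away from the multiples of `1 / ℓ`. -/
theorem exists_floor_eq {ℓ : ℕ} (hℓ : 0 < ℓ) {x : ℝ} {G : ℤ} (h1 : (G : ℝ) < x) (h2 : x < G + 1) :
    ∃ δ > 0, ∀ N a : ℕ, a < N → ∀ m : ℤ, |(a : ℝ) / N - x / ℓ - m| < δ →
      ((ℓ * a / N : ℕ) : ℤ) = G % ℓ := by
  have hℓ' : (0 : ℝ) < ℓ := by exact_mod_cast hℓ
  refine ⟨min (x - G) (G + 1 - x) / ℓ, div_pos (lt_min (by linarith) (by linarith)) hℓ', ?_⟩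
  intro N a haN m hm
  have hN : (0 : ℝ) < N := by exact_mod_cast (show 0 < N by omega)
  have h3 : |(ℓ : ℝ) * a / N - x - ℓ * m| < min (x - G) (G + 1 - x) := by
    have h4 : (ℓ : ℝ) * a / N - x - ℓ * m = ((a : ℝ) / N - x / ℓ - m) * ℓ := by
      field_simp
    rw [h4, abs_mul, abs_of_pos hℓ']
    exact (lt_div_iff₀ hℓ').1 hm
  obtain ⟨h4, h5⟩ := abs_lt.1 h3
  have h6 := min_le_left (x - G) (G + 1 - x)
  have h7 := min_le_right (x - G) (G + 1 - x)
  have hdiv : ((ℓ * a / N : ℕ) : ℤ) = ⌊(ℓ : ℝ) * a / N⌋ := by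
    have := Nat.floor_div_eq_div (K := ℝ) (ℓ * a) N
    rw [← this, ← Int.natCast_floor_eq_floor (by positivity)]
    push_cast
    rfl
  have hfl : ⌊(ℓ : ℝ) * a / N⌋ = G + ℓ * m := by
    rw [Int.floor_eq_iff]
    push_cast
    constructor <;> linarith
  have hlt : ((ℓ * a / N : ℕ) : ℤ) < ℓ := by
    have : ℓ * a / N < ℓ := by
      rw [Nat.div_lt_iff_lt_mul (by omega)]
      exact Nat.mul_lt_mul_of_pos_left haN hℓ
    exact_mod_cast this
  rw [← Int.emod_eq_of_lt (Int.natCast_nonneg _) hlt, hdiv, hfl, Int.add_mul_emod_self_left]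

end LinearFunctional

section Nonvanishing

variable {p : ℕ} [Fact p.Prime] {L : IntermediateField ℚ_[p] (PadicAlgCl p)}

/-- Evaluation of the congruences at a limit point: the fractional parts of `ζ v / p^{n+1}` may be
replaced by any real numbers satisfying the linear relations between the `ζ`. -/
theorem dvd_sum_floor (θ : DeltaHat p) {ℓ : ℕ} (hℓ : 0 < ℓ) (hpℓ : p.Coprime ℓ)
    {B : O L}
    (hB : ∀ n ≠ 0, ∀ u v : ℤ_[p], u = -(ℓ * v) → (p : ℤ_[p]) ∣ u - 1 →
      ¬ (p : ℤ_[p]) ^ 2 ∣ u - 1 →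
      (p : O L) ∣ ∑ ζ ∈ teich p,
        (B - ((ℓ * (ζ * v).appr (n + 1) / p ^ (n + 1) : ℕ) : O L)) *
          algebraMap ℤ_[p] (O L) (θ.twist ζ))
    {x : teich p → ℝ} {g : teich p → ℤ}
    (hx : ∀ k : teich p → ℤ, ∑ ζ, (k ζ : ℤ_[p]) * (ζ : ℤ_[p]) = 0 → ∑ ζ, (k ζ : ℝ) * x ζ = 0)
    (hg : ∀ ζ, (g ζ : ℝ) < x ζ ∧ x ζ < g ζ + 1) :
    (p : O L) ∣ ∑ ζ : teich p, (B - ((g ζ % ℓ : ℤ) : O L)) *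
      algebraMap ℤ_[p] (O L) (θ.twist ζ) := by
  have hp : p.Prime := Fact.out
  have hℓu : IsUnit (ℓ : ℤ_[p]) :=
    isUnit_of_not_dvd (natCast_not_dvd ((hp.coprime_iff_not_dvd).1 hpℓ))
  obtain ⟨b, hb⟩ := hℓu.exists_right_inv
  classical
  choose δ hδ0 hδ using fun ζ => exists_floor_eq hℓ (hg ζ).1 (hg ζ).2
  obtain ⟨ε, hε0, hε⟩ : ∃ ε > 0, ∀ ζ, ε ≤ δ ζ := by
    have hne : (Finset.univ : Finset (teich p)).Nonempty :=
      ⟨⟨1, mem_teich.2 (one_pow _)⟩, Finset.mem_univ _⟩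
    exact ⟨Finset.univ.inf' hne δ, (Finset.lt_inf'_iff hne).2 fun ζ _ => hδ0 ζ,
      fun ζ => Finset.inf'_le _ (Finset.mem_univ ζ)⟩
  -- the residue class of `v` modulo `p ^ 2` is chosen so that `-ℓ v ≡ 1 + p`
  have hclose := eventually_exists_close (fun ζ : teich p => (ζ : ℤ_[p])) (fun ζ => x ζ / ℓ)
    (fun k hk => by
      have := hx k hk
      simp_rw [← mul_div_assoc]
      rw [← Finset.sum_div, this, zero_div]) (-((1 + p) * b)) 2 hε0
  obtain ⟨n, ⟨v, hv, hvm⟩, hn⟩ := (hclose.and (Filter.eventually_ge_atTop 2)).exists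
  obtain ⟨n, rfl⟩ : ∃ m, n = m + 1 := ⟨n - 1, by omega⟩
  obtain ⟨e, he⟩ := hv
  have hu : -(ℓ * v) - 1 = (p : ℤ_[p]) + p ^ 2 * (-(ℓ * e)) := by
    rw [sub_eq_iff_eq_add] at he
    rw [he]
    linear_combination (1 + (p : ℤ_[p])) * hb
  have h1 := hB n (by omega) _ v rfl (by rw [hu]; exact ⟨1 + p * (-(ℓ * e)), by ring⟩) (by
    rw [hu, dvd_add_left (Dvd.intro _ rfl)]
    intro h
    rw [pow_two] at h
    have h2 := (mul_dvd_mul_iff_left PadicInt.prime_p.ne_zero).1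
      (h.trans (dvd_of_eq (mul_one (p : ℤ_[p])).symm))
    exact PadicInt.prime_p.not_isUnit (isUnit_of_dvd_one h2))
  rw [← Finset.sum_coe_sort] at h1
  convert h1 using 1
  refine Finset.sum_congr rfl fun ζ _ => ?_
  obtain ⟨m, hm⟩ := hvm ζ
  have h2 := hδ ζ (p ^ (n + 1)) _ (PadicInt.appr_lt ((ζ : ℤ_[p]) * v) (n + 1)) m
    (by push_cast; exact hm.trans_le (hε ζ))
  rw [← h2, Int.cast_natCast]

theorem DeltaHat.twist_one (θ : DeltaHat p) : θ.twist 1 = 1 := by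
  rw [DeltaHat.twist, θ.val_one, omega_eq (one_pow _) (by simp), Ring.inverse_one, one_mul]

theorem neg_one_pow_sub_one (hp2 : p ≠ 2) : (-1 : ℤ_[p]) ^ (p - 1) = 1 :=
  Even.neg_one_pow ((Fact.out : p.Prime).even_sub_one hp2)

theorem DeltaHat.IsEven.twist_neg_one (hp2 : p ≠ 2) {θ : DeltaHat p} (hθ : θ.IsEven) :
    θ.twist (-1) = -1 := by
  have h1 : Ring.inverse (-1 : ℤ_[p]) = -1 := by
    have := Ring.inverse_mul_cancel (-1 : ℤ_[p]) isUnit_one.neg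
    rwa [mul_neg_one, neg_eq_iff_eq_neg] at this
  rw [DeltaHat.twist, hθ, omega_eq (neg_one_pow_sub_one hp2) (by simp), h1, one_mul]

/-- The derivative of `∑ M(T, θ, ρ)` does not vanish modulo `p`, for any `ℓ > 1` prime to `p`. -/
theorem not_dvd_sum_derivative [FiniteDimensional ℚ_[p] L] (hp2 : p ≠ 2) {θ : DeltaHat p}
    (hθ : θ.IsEven) {ℓ : ℕ} (hℓ : 1 < ℓ) (hpℓ : p.Coprime ℓ)
    (hL : ∀ z : PadicAlgCl p, z ^ ℓ = 1 → z ∈ L) :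
    ¬ (p : (O L)⟦X⟧) ∣ ∑ ρ ∈ muMinusOne L ℓ,
      PowerSeries.derivative (O L) (mirimanoff θ ρ) := by
  intro hd
  have hp : p.Prime := Fact.out
  obtain ⟨B, hB⟩ := dvd_sum_teich hp2 θ (by omega) hpℓ hL hd
  obtain ⟨lam, hrel, hlam1, hlam2, hgen⟩ := exists_generic_functional p
  -- scaling by `1 ± η` moves the point across the walls `y₁ = 1/ℓ` and `y₋₁ = -1/ℓ` only
  have hη : ∀ᶠ η : ℝ in nhds 0, ∀ ζ : teich p, (ζ : ℤ_[p]) ≠ 1 → (ζ : ℤ_[p]) ≠ -1 →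
      (1 + η) * lam ζ ∈ Set.Ioo (⌊lam ζ⌋ : ℝ) (⌊lam ζ⌋ + 1) := by
    rw [Filter.eventually_all]
    intro ζ
    by_cases h : (ζ : ℤ_[p]) ≠ 1 ∧ (ζ : ℤ_[p]) ≠ -1
    · have hcont : Filter.Tendsto (fun η : ℝ => (1 + η) * lam ζ) (nhds 0) (nhds (lam ζ)) := by
        have : Continuous fun η : ℝ => (1 + η) * lam ζ := by fun_prop
        simpa using this.tendsto 0
      have hmem : lam ζ ∈ Set.Ioo (⌊lam ζ⌋ : ℝ) (⌊lam ζ⌋ + 1) :=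
        ⟨lt_of_le_of_ne (Int.floor_le _) (hgen ζ h.1 h.2 _).symm, Int.lt_floor_add_one _⟩
      filter_upwards [hcont.eventually (Ioo_mem_nhds hmem.1 hmem.2)] with η hη _ _ using hη
    · exact Filter.Eventually.of_forall fun η h1 h2 => absurd ⟨h1, h2⟩ h
  have hη' : ∀ᶠ η : ℝ in nhds 0, ∀ ζ : teich p, (ζ : ℤ_[p]) ≠ 1 → (ζ : ℤ_[p]) ≠ -1 →
      (1 - η) * lam ζ ∈ Set.Ioo (⌊lam ζ⌋ : ℝ) (⌊lam ζ⌋ + 1) := by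
    have : Filter.Tendsto (fun η : ℝ => -η) (nhds 0) (nhds 0) := by
      simpa using (continuous_neg (G := ℝ)).tendsto 0
    simpa [sub_eq_add_neg] using this.eventually hη
  obtain ⟨η, ⟨⟨h1, h2⟩, h3⟩, h4⟩ :=
    ((((hη.and hη').filter_mono nhdsWithin_le_nhds).and
      ((eventually_lt_nhds (zero_lt_one (α := ℝ))).filter_mono nhdsWithin_le_nhds)).and
      (self_mem_nhdsWithin (s := Set.Ioi (0 : ℝ)))).exists
  have h4 : 0 < η := h4
  have hne : (1 : ℤ_[p]) ≠ -1 := by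
    intro h
    have h5 : (p : ℤ_[p]) ∣ 1 - (-1) := by rw [← h, sub_self]; exact dvd_zero _
    have h6 : (p : ℤ_[p]) ∣ ((2 : ℕ) : ℤ_[p]) := by
      convert h5 using 1
      norm_num
    exact hp2 ((Nat.prime_dvd_prime_iff_eq hp Nat.prime_two).1 (dvd_natCast_iff.1 h6))
  classical
  set gp : teich p → ℤ := fun ζ => if (ζ : ℤ_[p]) = 1 then 1 else if (ζ : ℤ_[p]) = -1 then -2 else
    ⌊lam ζ⌋ with hgp
  set gm : teich p → ℤ := fun ζ => if (ζ : ℤ_[p]) = 1 then 0 else if (ζ : ℤ_[p]) = -1 then -1 else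
    ⌊lam ζ⌋ with hgm
  have hscale : ∀ c : ℝ, ∀ k : teich p → ℤ, ∑ ζ, (k ζ : ℤ_[p]) * (ζ : ℤ_[p]) = 0 →
      ∑ ζ, (k ζ : ℝ) * (c * lam ζ) = 0 := by
    intro c k hk
    have := hrel k hk
    simp_rw [mul_left_comm _ c]
    rw [← Finset.mul_sum, this, mul_zero]
  have hP := dvd_sum_floor θ (by omega) hpℓ hB (hscale (1 + η)) (g := gp) (fun ζ => by
    simp only [hgp]
    split_ifs with h5 h6
    · rw [hlam1 ζ h5]; push_cast; constructor <;> linarith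
    · rw [hlam2 ζ h6]; push_cast; constructor <;> linarith
    · exact h1 ζ h5 h6)
  have hM := dvd_sum_floor θ (by omega) hpℓ hB (hscale (1 - η)) (g := gm) (fun ζ => by
    simp only [hgm]
    split_ifs with h5 h6
    · rw [hlam1 ζ h5]; push_cast; constructor <;> linarith
    · rw [hlam2 ζ h6]; push_cast; constructor <;> linarith
    · exact h2 ζ h5 h6)
  have hsub := hM.sub hP
  rw [← Finset.sum_sub_distrib] at hsub
  have h1mem : (1 : ℤ_[p]) ∈ teich p := mem_teich.2 (one_pow _)
  have h2mem : (-1 : ℤ_[p]) ∈ teich p := mem_teich.2 (neg_one_pow_sub_one hp2)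
  rw [Fintype.sum_eq_add (⟨1, h1mem⟩ : teich p) ⟨-1, h2mem⟩
    (fun h => hne (congrArg Subtype.val h)) (fun ζ hζ => by
      have h5 : (ζ : ℤ_[p]) ≠ 1 := fun h => hζ.1 (Subtype.ext h)
      have h6 : (ζ : ℤ_[p]) ≠ -1 := fun h => hζ.2 (Subtype.ext h)
      simp only [hgp, hgm, if_neg h5, if_neg h6, sub_self])] at hsub
  have e1 : (1 : ℤ) % ℓ = 1 := Int.emod_eq_of_lt (by norm_num) (by exact_mod_cast hℓ)
  have e2 : (-2 : ℤ) % ℓ = ℓ - 2 := by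
    rw [← Int.add_emod_right, Int.emod_eq_of_lt] <;> omega
  have e3 : (-1 : ℤ) % ℓ = ℓ - 1 := by
    rw [← Int.add_emod_right, Int.emod_eq_of_lt] <;> omega
  simp only [hgp, hgm, if_true, if_neg hne.symm, e1, e2, e3, Int.zero_emod, θ.twist_one,
    hθ.twist_neg_one hp2, map_one, map_neg] at hsub
  have h7 : (p : O L) ∣ ((2 : ℕ) : O L) := by
    convert hsub using 1
    push_cast
    ring
  have h8 : IsUnit ((2 : ℕ) : O L) := isUnit_natCast_O fun h =>
    hp2 ((Nat.prime_dvd_prime_iff_eq hp Nat.prime_two).1 h)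
  exact not_isUnit_p L (isUnit_of_dvd_unit h7 h8)

end Nonvanishing

end Mirimanoff

end

theorem theorem3p5 (p : ℕ) [Fact p.Prime] (hp : 5 ≤ p) (θ : Mirimanoff.DeltaHat p)
    (hθ : θ.IsEven) :
    ∃ α ∈ rootsOfUnity (p - 1) ℤ_[p], ∀ ℓ : ℕ, ℓ.Prime →
      (p : ℤ_[p]) ∣ (ℓ : ℤ_[p]) - (α : ℤ_[p]) → p ^ 2 ≤ ℓ →
      ∀ L : IntermediateField ℚ_[p] (PadicAlgCl p), FiniteDimensional ℚ_[p] L →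
        (∀ z : PadicAlgCl p, z ^ ℓ = 1 → z ∈ L) →
        ¬ (p : PowerSeries (Mirimanoff.O L)) ∣
          ∑ ρ ∈ Mirimanoff.muMinusOne L ℓ,
            PowerSeries.derivative (Mirimanoff.O L) (Mirimanoff.mirimanoff θ ρ) := by
  refine ⟨1, one_mem _, fun ℓ hℓ hα _ L _ hL => ?_⟩
  have hpℓ : p.Coprime ℓ := by
    rw [(Fact.out : p.Prime).coprime_iff_not_dvd]
    intro h
    have h1 := (Mirimanoff.dvd_natCast_iff (p := p)).2 h
    have h2 : (p : ℤ_[p]) ∣ 1 := by simpa using h1.sub hα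
    exact PadicInt.prime_p.not_isUnit (isUnit_of_dvd_one h2)
  exact Mirimanoff.not_dvd_sum_derivative (by omega) hθ hℓ.one_lt hpℓ hL
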